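/- Definitions. Let $(X,\lambda)$ be a standard Borel probability space. A graphing on $(X,\lambda)$ is a simple graph on $X$ whose set $E$ of directed edges (both directions of every edge are in $E$) is a countable union of graphs of measure preserving injective partial maps of $X$; it is a treeing if $\lambda$-almost no vertex lies on a cycle. If every vertex has degree $D$, the edge measure on $E$ is $\eta(S)=\frac1D\int_X \deg_S(x)\,d\lambda(x)$, where $\deg_S(x)=|\{y:(x,y)\in E\cap S\}|$. Properties are understood up to null sets. A circulation is an antisymmetric function $f:E\to\mathbb R$ with $\sum_{y:(x,y)\in E}f(x,y)=0$ for almost every $x$. A measurable balanced orientation of a $2d$-regular graphing is a measurable set $O\subseteq E$ containing exactly one of $(x,y),(y,x)$ for every edge, with all out- and indegrees equal to $d$; its circulation $\alpha_O$ is $1$ on $O$ and $-1$ on the reversed edges. A measurable Schreier decoration is a measurable balanced orientation together with a measurable labelling of the oriented edges by $d$ labels such that, for every label, all out- and indegrees are $1$. A path-cycle system is the set $P\subseteq E$ of directed edges of a family of pairwise vertex-disjoint finite directed cycles and two-way infinite directed paths; the function it carries is $\alpha_P=1_P-1_{P^{-1}}$, where $P^{-1}=\{(y,x):(x,y)\in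 P\}$. Theorem. For every integer $d\ge 2$ there are a standard Borel probability space $(X,\lambda)$, a $2d$-regular treeing on it, and a measurable balanced orientation $O$ of this treeing such that: 1. a function $f\in L^2(E,\eta)$ is a circulation if and only if $f=c\,\alpha_O$ $\eta$-almost everywhere for some constant $c\in\mathbb R$; 2. the treeing has no measurable Schreier decoration, and it is not generated by an essentially free measurable action of the free group $\mathbb F_d$, i.e., there is no such action for which almost every $x\in X$ is adjacent exactly to the images of $x$ under the $d$ free generators and their inverses; 3. $\alpha_O$ does not decompose into finite directed cycles and two-way infinite directed paths: it is not $\eta$-almost everywhere a nonnegative linear combination of circulations $\alpha_P$ carried by measurable path-cycle systems, neither a finite or countable one nor, more generally, an integral $\int_\Omega \alpha_{P_\omega}\,d\nu(\omega)$ over a jointly measurable family $(P_\omega)_{\omega\in\Omega}$ of path-cycle systems with respect to an s-finite measure $\nu$. -/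

import Mathlib

open MeasureTheory
open scoped ENNReal

/-- `f`, restricted to `A`, is a measure preserving partial injection of `(X, μ)`: an injective
measurable map from `A` onto `f '' A` that carries the measure of `A` to that of `f '' A`. -/
structure IsPmpPartialMap {X : Type*} [MeasurableSpace X] (μ : Measure X)
    (A : Set X) (f : X → X) : Prop where
  measurableSet : MeasurableSet A
  injOn : Set.InjOn f A
  measurePreserving : MeasurePreserving f (μ.restrict A) (μ.restrict (f '' A))

/-- A graphing: the set of (directed) edges is a countable union of graphs of measure preserving
partial maps. -/
def IsGraphing {X : Type*} [MeasurableSpace X] (G : SimpleGraph X) (μ : Measure X) : Prop :=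
  ∃ (A : ℕ → Set X) (f : ℕ → X → X), (∀ i, IsPmpPartialMap μ (A i) (f i)) ∧
    ∀ x y, G.Adj x y ↔ ∃ i, x ∈ A i ∧ f i x = y

/-- A treeing: an essentially acyclic graphing (almost no vertex lies on a cycle). -/
structure IsTreeing {X : Type*} [MeasurableSpace X] (G : SimpleGraph X) (μ : Measure X) :
    Prop where
  isGraphing : IsGraphing G μ
  ae_acyclic : ∀ᵐ x ∂μ, ∀ c : G.Walk x x, ¬ c.IsCycle

/-- Every vertex has exactly `D` neighbours. -/
def IsRegularGraph {X : Type*} (G : SimpleGraph X) (D : ℕ) : Prop :=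
  ∀ x, (G.neighborSet x).encard = D

/-- The counting measure on the set of directed edges of `G` that start at `x`. -/
noncomputable def outMeasure {X : Type*} [MeasurableSpace X] (G : SimpleGraph X) (x : X) :
    Measure (X × X) :=
  (Measure.count.restrict (G.neighborSet x)).map (Prod.mk x)

/-- The edge measure of a `D`-regular graphing, `η(S) = (1 / D) ∫ deg_S(x) dμ(x)`, as a measure on
directed edges; see `edgeMeasure_apply`. -/
noncomputable def edgeMeasure {X : Type*} [MeasurableSpace X] (G : SimpleGraph X)
    (μ : Measure X) (D : ℕ) : Measure (X × X) :=
  (D : ℝ≥0∞)⁻¹ • μ.bind (outMeasure G)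

theorem outMeasure_apply {X : Type*} [MeasurableSpace X] [StandardBorelSpace X]
    {G : SimpleGraph X} {μ : Measure X} (hG : IsGraphing G μ) (x : X) {S : Set (X × X)}
    (hS : MeasurableSet S) :
    outMeasure G x S = ({y | G.Adj x y ∧ (x, y) ∈ S}.encard : ℝ≥0∞) := by
  obtain ⟨A, f, -, hadj⟩ := hG
  have hN : (G.neighborSet x).Countable := by
    refine (Set.countable_range fun i => f i x).mono ?_
    intro y hy
    obtain ⟨i, -, hi⟩ := (hadj x y).1 hy
    exact ⟨i, hi⟩
  have hm : MeasurableSet (Prod.mk x ⁻¹' S) := measurable_prodMk_left hS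
  rw [outMeasure, Measure.map_apply measurable_prodMk_left hS, Measure.restrict_apply hm,
    Measure.count_apply (hm.inter hN.measurableSet)]
  congr 2
  ext y
  simp [and_comm]

theorem measurable_outMeasure {X : Type*} [MeasurableSpace X] [StandardBorelSpace X]
    {G : SimpleGraph X} {μ : Measure X} (hG : IsGraphing G μ) : Measurable (outMeasure G) := by
  refine Measure.measurable_of_measurable_coe _ fun S hS => ?_
  simp_rw [outMeasure_apply hG _ hS]
  obtain ⟨A, f, hf, hadj⟩ := hG
  classical
  have hfm : ∀ i, Measurable (f i) := fun i => (hf i).measurePreserving.measurable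
  let B : ℕ → Set X := fun i =>
    (A i ∩ {x | (x, f i x) ∈ S}) ∩ ⋂ j, ⋂ (_ : j < i), (A j ∩ {x | f j x = f i x})ᶜ
  have hB : ∀ i, MeasurableSet (B i) := fun i =>
    ((hf i).measurableSet.inter ((measurable_id.prodMk (hfm i)) hS)).inter
      (MeasurableSet.iInter fun j => MeasurableSet.iInter fun _ =>
        ((hf j).measurableSet.inter (measurableSet_eq_fun (hfm j) (hfm i))).compl)
  have key : ∀ x, (({y | G.Adj x y ∧ (x, y) ∈ S}.encard : ℕ∞) : ℝ≥0∞)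
      = ∑' i, (B i).indicator (fun _ => (1 : ℝ≥0∞)) x := by
    intro x
    have h1 : {y | G.Adj x y ∧ (x, y) ∈ S} = (fun i => f i x) '' {i | x ∈ B i} := by
      ext y
      constructor
      · rintro ⟨hy, hyS⟩
        have hex : ∃ i, x ∈ A i ∧ f i x = y := (hadj x y).1 hy
        obtain ⟨h2, h3⟩ := Nat.find_spec hex
        refine ⟨Nat.find hex, ⟨⟨h2, ?_⟩, ?_⟩, h3⟩
        · simpa [h3] using hyS
        · simp only [Set.mem_iInter]
          rintro j hj ⟨hj1, hj2⟩
          exact Nat.find_min hex hj ⟨hj1, hj2.trans h3⟩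
      · rintro ⟨i, ⟨⟨hi, hiS⟩, -⟩, rfl⟩
        exact ⟨(hadj _ _).2 ⟨i, hi, rfl⟩, hiS⟩
    have hinj : Set.InjOn (fun i => f i x) {i | x ∈ B i} := by
      have aux : ∀ i j, x ∈ B i → x ∈ B j → f i x = f j x → ¬ i < j := by
        intro i j hi hj h hlt
        have h4 := hj.2
        simp only [Set.mem_iInter] at h4
        exact h4 i hlt ⟨hi.1.1, h⟩
      intro i hi j hj h
      exact le_antisymm (not_lt.1 (aux j i hj hi h.symm)) (not_lt.1 (aux i j hi hj h))
    rw [h1, hinj.encard_image, ← ENNReal.tsum_set_one,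
      tsum_subtype {i | x ∈ B i} (fun _ => (1 : ℝ≥0∞))]
    rfl
  simp_rw [key]
  exact Measurable.tsum fun i => measurable_const.indicator (hB i)

/-- The edge measure is given by the expected formula. -/
theorem edgeMeasure_apply {X : Type*} [MeasurableSpace X] [StandardBorelSpace X]
    {G : SimpleGraph X} {μ : Measure X} (hG : IsGraphing G μ) (D : ℕ) {S : Set (X × X)}
    (hS : MeasurableSet S) :
    edgeMeasure G μ D S =
      (D : ℝ≥0∞)⁻¹ * ∫⁻ x, ({y | G.Adj x y ∧ (x, y) ∈ S}.encard : ℝ≥0∞) ∂μ := by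
  rw [edgeMeasure, Measure.smul_apply, Measure.bind_apply hS (measurable_outMeasure hG).aemeasurable,
    smul_eq_mul]
  simp_rw [outMeasure_apply hG _ hS]

/-- A circulation (up to null sets): an antisymmetric function on directed edges whose values on the
edges at almost every vertex sum to zero. -/
structure IsCirculation {X : Type*} [MeasurableSpace X] (G : SimpleGraph X) (μ : Measure X)
    (D : ℕ) (f : X × X → ℝ) : Prop where
  antisymm : ∀ᵐ e ∂(edgeMeasure G μ D), f e.swap = -f e
  conservation : ∀ᵐ x ∂μ, ∑ᶠ y ∈ G.neighborSet x, f (x, y) = 0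

/-- A measurable balanced orientation (up to null sets) of a `2d`-regular graphing: `O` contains
exactly one of the two directions of every edge, and all out- and indegrees are `d`. Only the pairs
in `O` that are edges of `G` matter. -/
structure IsBalancedOrientation {X : Type*} [MeasurableSpace X] (G : SimpleGraph X)
    (μ : Measure X) (d : ℕ) (O : Set (X × X)) : Prop where
  measurableSet : MeasurableSet O
  orients : ∀ᵐ x ∂μ, ∀ y, G.Adj x y → Xor ((x, y) ∈ O) ((y, x) ∈ O)
  outdegree : ∀ᵐ x ∂μ, {y | G.Adj x y ∧ (x, y) ∈ O}.encard = d
  indegree : ∀ᵐ x ∂μ, {y | G.Adj x y ∧ (y, x) ∈ O}.encard = d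

/-- The antisymmetric edge function of a set `S` of directed edges: `1` on `S`, `-1` on the reversed
edges (and `0` where both apply). -/
noncomputable def signedIndicator {X : Type*} (S : Set (X × X)) (e : X × X) : ℝ :=
  S.indicator 1 e - S.indicator 1 e.swap

/-- A measurable Schreier decoration: a balanced orientation `O` with a measurable labelling `c` of
the oriented edges by `d` labels such that, for every label, all out- and indegrees are `1`. -/
structure IsSchreierDecoration {X : Type*} [MeasurableSpace X] (G : SimpleGraph X)
    (μ : Measure X) (d : ℕ) (O : Set (X × X)) (c : X × X → Fin d) : Prop where
  balanced : IsBalancedOrientation G μ d O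
  measurable : Measurable c
  out_label : ∀ᵐ x ∂μ, ∀ i, ∃! y, G.Adj x y ∧ (x, y) ∈ O ∧ c (x, y) = i
  in_label : ∀ᵐ x ∂μ, ∀ i, ∃! y, G.Adj x y ∧ (y, x) ∈ O ∧ c (y, x) = i

/-- `G` is generated by an essentially free measurable action of the free group of rank `d`: almost
every vertex `x` is adjacent exactly to its images under the free generators and their inverses.
(In a graphing such an action automatically preserves the measure, so this is not required.) -/
def IsGeneratedByFreeAction {X : Type*} [MeasurableSpace X] (G : SimpleGraph X)
    (μ : Measure X) (d : ℕ) : Prop :=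
  ∃ _ : MulAction (FreeGroup (Fin d)) X,
    (∀ g : FreeGroup (Fin d), Measurable fun x : X => g • x) ∧
    (∀ᵐ x ∂μ, ∀ g : FreeGroup (Fin d), g ≠ 1 → g • x ≠ x) ∧
    ∀ᵐ x ∂μ, ∀ y, G.Adj x y ↔
      ∃ i : Fin d, FreeGroup.of i • x = y ∨ (FreeGroup.of i)⁻¹ • x = y

/-- `p : ℤ → X` traverses a two-way infinite directed path of `G`, or runs periodically around a
finite directed cycle of `G` of length `m`. -/
def IsPathOrCycle {X : Type*} (G : SimpleGraph X) (p : ℤ → X) : Prop :=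
  (∀ n, G.Adj (p n) (p (n + 1))) ∧
    (Function.Injective p ∨ ∃ m : ℕ, 0 < m ∧ ∀ j k : ℤ, p j = p k ↔ (m : ℤ) ∣ j - k)

/-- `P` is the set of directed edges of a family of pairwise vertex-disjoint finite directed cycles
and two-way infinite directed paths of `G`. -/
def IsPathCycleSystem {X : Type*} (G : SimpleGraph X) (P : Set (X × X)) : Prop :=
  ∃ C : Set (ℤ → X), (∀ p ∈ C, IsPathOrCycle G p) ∧
    C.PairwiseDisjoint (fun p => Set.range p) ∧
    P = {e | ∃ p ∈ C, ∃ n : ℤ, e = (p n, p (n + 1))}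

/-- The edge function `f` is, up to a null set of edges, a nonnegative linear combination (finite,
countable, or an integral against an s-finite measure `ν`, measurable in all variables) of the
circulations carried by measurable systems of vertex-disjoint finite directed cycles and two-way
infinite directed paths. -/
def DecomposesIntoPathsAndCycles {X : Type*} [MeasurableSpace X] (G : SimpleGraph X)
    (μ : Measure X) (D : ℕ) (f : X × X → ℝ) : Prop :=
  ∃ (Ω : Type) (_ : MeasurableSpace Ω) (ν : Measure Ω) (_ : SFinite ν)
    (P : Ω → Set (X × X)),
    MeasurableSet {q : Ω × (X × X) | q.2 ∈ P q.1} ∧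
    (∀ w, IsPathCycleSystem G (P w)) ∧
    ∀ᵐ e ∂(edgeMeasure G μ D), Integrable (fun w => signedIndicator (P w) e) ν ∧
      ∫ w, signedIndicator (P w) e ∂ν = f e

/-! A measure preserving permutation `τ` of `X × Fin d` encodes a directed graph: each pair is an
edge from its own vertex to the vertex of its image, so there are `d` outgoing and `d` incoming
edges everywhere. The labels at the two ends of an edge are unrelated, so no Schreier decoration
results. Two properties of `τ` suffice. `IsSeparating` makes the graph a simple forest;
`HasUniqueFlow` makes every L² circulation a multiple of `α_O`.

The negative statements rest on `signedIndicator_ae_eq_zero`: a measurable path-cycle system carries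
a bounded circulation, hence a multiple of `α_O`. It misses some of the `2d ≥ 4` edges at a vertex,
while `α_O` is `±1` on all of them, so the multiple is zero. A label class of a Schreier decoration,
or the graph of a free generator, would carry a nonzero function; Fubini excludes integrals of such
systems.

To build `τ`, let `X` be a product of cyclic groups of orders `M n + 1`. For each `n` choose two
cylinders in `X × Fin d`, fixing the label and only coordinates before `n`; `turn` adds `1` to
coordinate `n` over the first and subtracts `1` over the second. Apart from wrap-around, the
coboundary of coordinate `n`, read as an integer, is the difference of the two indicators. Flows are
orthogonal to coboundaries, so a flow would have equal integrals over the two cylinders. But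
wrap-around causes an error of size `M n + 1` on a set of measure of order `1 / (M n + 1)`, which is
too large in L². Hence `swap n` exchanges the ends of the edges that wrap over the first cylinder
with the ends of those that wrap over the second: the error there drops to `1`. Later swaps spoil
coordinate `n` only on a set of measure of order `(M n + 1)⁻³`, so the L² error tends to zero
(`integral_sq_deviation_le`). Every pair of cylinders recurs infinitely often, so a flow has equal
integrals over all cylinders of one level and is constant (`hasUniqueFlow`).

The same coordinates separate edges (`exists_separating_coord`): let the first cylinder isolate one
edge of a finite set and the second avoid the set. -/

/-! ### Graphs of edge permutations: regularity and acyclicity -/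

section EdgePermutation

variable {X : Type*} {d : ℕ}

/-- The graph of a permutation `τ` of `X × Fin d`: the pair `(x, i)` is an edge from `x` to the first
component of `τ (x, i)`. -/
def edgePermGraph (τ : X × Fin d ≃ X × Fin d) : SimpleGraph X where
  Adj x y := x ≠ y ∧ ((∃ i, (τ (x, i)).1 = y) ∨ ∃ i, (τ (y, i)).1 = x)
  symm := ⟨fun _ _ h => ⟨h.1.symm, h.2.symm⟩⟩
  loopless := ⟨fun _ h => h.1 rfl⟩

/-- The edges of `edgePermGraph τ` in the direction of `τ`. -/
def edgePermOrientation (τ : X × Fin d ≃ X × Fin d) : Set (X × X) :=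
  {e | ∃ i, (τ (e.1, i)).1 = e.2}

/-- For all finite sets of edges and every edge `y₀`, some vertex function is constant along the
edges of the set other than `y₀` but not along `y₀`. -/
def IsSeparating (τ : X × Fin d ≃ X × Fin d) : Prop :=
  ∀ (F : Finset (X × Fin d)) (y₀ : X × Fin d), ∃ ψ : X → ℕ, ψ (τ y₀).1 ≠ ψ y₀.1 ∧
    ∀ y ∈ F, y ≠ y₀ → ψ (τ y).1 = ψ y.1

/-- The out-neighbours (left) and in-neighbours (right) of a vertex. -/
def edgePermNeighbor (τ : X × Fin d ≃ X × Fin d) (x : X) : Fin d ⊕ Fin d → X :=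
  Sum.elim (fun i => (τ (x, i)).1) fun i => (τ.symm (x, i)).1

namespace IsSeparating

variable {τ : X × Fin d ≃ X × Fin d}

theorem ne_fst (h : IsSeparating τ) (y : X × Fin d) : (τ y).1 ≠ y.1 := by
  obtain ⟨ψ, h1, -⟩ := h ∅ y
  exact fun h2 => h1 (by rw [h2])

/-- Every vertex function has the same increment along parallel edges, so none can be constant along
just one of them. -/
theorem eq_of_parallel (h : IsSeparating τ) {y y' : X × Fin d} (h1 : y.1 = y'.1)
    (h2 : (τ y).1 = (τ y').1) : y = y' := by
  by_contra hne
  obtain ⟨ψ, h3, h4⟩ := h {y'} y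
  refine h3 ?_
  rw [h1, h2]
  exact h4 y' (by simp) (Ne.symm hne)

theorem not_antiparallel (h : IsSeparating τ) {y y' : X × Fin d} (h1 : (τ y).1 = y'.1)
    (h2 : (τ y').1 = y.1) : False := by
  by_cases hne : y' = y
  · subst hne
    exact h.ne_fst _ h1
  obtain ⟨ψ, h3, h4⟩ := h {y'} y
  refine h3 ?_
  rw [h1, ← h2]
  exact (h4 y' (by simp) hne).symm

theorem neighbor_injective (h : IsSeparating τ) (x : X) :
    Function.Injective (edgePermNeighbor τ x) := by
  rintro (i | i) (j | j) hij <;> simp only [edgePermNeighbor, Sum.elim_inl, Sum.elim_inr] at hij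
  · have := h.eq_of_parallel (y := (x, i)) (y' := (x, j)) rfl hij
    simp_all
  · exact (h.not_antiparallel (y := (x, i)) (y' := τ.symm (x, j)) hij (by simp)).elim
  · exact (h.not_antiparallel (y := (x, j)) (y' := τ.symm (x, i)) hij.symm (by simp)).elim
  · have := h.eq_of_parallel (y := τ.symm (x, i)) (y' := τ.symm (x, j)) hij (by simp)
    simpa using this

theorem adj_iff (h : IsSeparating τ) {x y : X} :
    (edgePermGraph τ).Adj x y ↔ ∃ k, edgePermNeighbor τ x k = y := by
  constructor
  · rintro ⟨-, ⟨i, hi⟩ | ⟨i, hi⟩⟩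
    · exact ⟨Sum.inl i, hi⟩
    · refine ⟨Sum.inr (τ (y, i)).2, ?_⟩
      have : (x, (τ (y, i)).2) = τ (y, i) := by rw [← hi]
      simp [edgePermNeighbor, this]
  · rintro ⟨i | i, rfl⟩
    · exact ⟨(h.ne_fst (x, i)).symm, Or.inl ⟨i, rfl⟩⟩
    · refine ⟨?_, Or.inr ⟨(τ.symm (x, i)).2, by simp [edgePermNeighbor]⟩⟩
      simpa [edgePermNeighbor] using h.ne_fst (τ.symm (x, i))

theorem neighborSet_eq (h : IsSeparating τ) (x : X) :
    (edgePermGraph τ).neighborSet x = Set.range (edgePermNeighbor τ x) := by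
  ext y
  simp [h.adj_iff]

theorem isRegularGraph (h : IsSeparating τ) : IsRegularGraph (edgePermGraph τ) (2 * d) := by
  intro x
  rw [h.neighborSet_eq, ← Set.image_univ, (h.neighbor_injective x).encard_image, Set.encard_univ]
  simp [two_mul]

theorem mem_orientation_inl (x : X) (i : Fin d) :
    (x, edgePermNeighbor τ x (Sum.inl i)) ∈ edgePermOrientation τ := ⟨i, rfl⟩

theorem mem_orientation_inr (x : X) (i : Fin d) :
    (edgePermNeighbor τ x (Sum.inr i), x) ∈ edgePermOrientation τ :=
  ⟨(τ.symm (x, i)).2, by simp [edgePermNeighbor]⟩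

theorem notMem_orientation_inr (h : IsSeparating τ) (x : X) (i : Fin d) :
    (x, edgePermNeighbor τ x (Sum.inr i)) ∉ edgePermOrientation τ := by
  rintro ⟨j, hj⟩
  exact Sum.inl_ne_inr (h.neighbor_injective x (a₁ := Sum.inl j) hj)

theorem notMem_orientation_inl (h : IsSeparating τ) (x : X) (i : Fin d) :
    (edgePermNeighbor τ x (Sum.inl i), x) ∉ edgePermOrientation τ := by
  rintro ⟨j, hj⟩
  exact h.not_antiparallel (y := (x, i)) (y' := ((τ (x, i)).1, j)) rfl hj

theorem signedIndicator_inl (h : IsSeparating τ) (x : X) (i : Fin d) :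
    signedIndicator (edgePermOrientation τ) (x, edgePermNeighbor τ x (Sum.inl i)) = 1 := by
  simp [signedIndicator, mem_orientation_inl, h.notMem_orientation_inl]

theorem signedIndicator_inr (h : IsSeparating τ) (x : X) (i : Fin d) :
    signedIndicator (edgePermOrientation τ) (x, edgePermNeighbor τ x (Sum.inr i)) = -1 := by
  simp [signedIndicator, mem_orientation_inr, h.notMem_orientation_inr]

theorem signedIndicator_ne_zero (h : IsSeparating τ) (x : X) (k : Fin d ⊕ Fin d) :
    signedIndicator (edgePermOrientation τ) (x, edgePermNeighbor τ x k) ≠ 0 := by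
  rcases k with i | i
  · simp [h.signedIndicator_inl]
  · simp [h.signedIndicator_inr]

/-- A vertex function cannot change along exactly one edge of a cycle. -/
theorem isAcyclic (h : IsSeparating τ) (x : X) (c : (edgePermGraph τ).Walk x x) : ¬ c.IsCycle := by
  classical
  intro hc
  have const : ∀ (ψ : X → ℕ) {u v : X} (p : (edgePermGraph τ).Walk u v),
      (∀ a b, s(a, b) ∈ p.edges → ψ a = ψ b) → ψ u = ψ v := by
    intro ψ u v p
    induction p with
    | nil => intro _; rfl
    | cons hadj p ih =>
      intro hp
      exact (hp _ _ (by simp)).trans (ih fun a b hab => hp a b (by simp [hab]))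
  cases c with
  | nil => exact SimpleGraph.Walk.not_isCycle_nil hc
  | @cons _ y _ hadj p =>
    have hnot : s(x, y) ∉ p.edges := ((SimpleGraph.Walk.isTrail_cons _ _).1 hc.isTrail).2
    have edge : ∀ {a b}, (edgePermGraph τ).Adj a b → ∃ e : X × Fin d,
        s(e.1, (τ e).1) = s(a, b) := by
      rintro a b ⟨-, ⟨i, hi⟩ | ⟨i, hi⟩⟩
      · exact ⟨(a, i), by simp [hi]⟩
      · exact ⟨(b, i), by simp [hi, Sym2.eq_swap]⟩
    obtain ⟨y₀, hy₀⟩ := edge hadj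
    -- All edges that start on the rest of the cycle: a finite set containing each of its edges, in
    -- whichever direction it is traversed.
    obtain ⟨ψ, h1, h2⟩ := h (p.support.toFinset ×ˢ Finset.univ) y₀
    have hψ : ψ y = ψ x := by
      refine const ψ p fun a b hab => ?_
      obtain ⟨e, he⟩ := edge (p.adj_of_mem_edges hab)
      have hne : e ≠ y₀ := by
        rintro rfl
        exact hnot (by rw [← hy₀, he]; exact hab)
      have hmem : e ∈ p.support.toFinset ×ˢ Finset.univ := by
        have h5 : s(e.1, (τ e).1) ∈ p.edges := he ▸ hab
        simpa using p.fst_mem_support_of_mem_edges h5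
      have h6 := h2 e hmem hne
      rcases Sym2.eq_iff.1 he with ⟨h7, h8⟩ | ⟨h7, h8⟩
      · rw [← h7, ← h8, h6]
      · rw [← h7, ← h8, h6]
    refine h1 ?_
    rcases Sym2.eq_iff.1 hy₀ with ⟨h7, h8⟩ | ⟨h7, h8⟩
    · rw [h7, h8, hψ]
    · rw [h7, h8, hψ]

end IsSeparating

end EdgePermutation

/-! ### The graphing of an edge permutation and its edge measure -/

section EdgePermutationMeasure

theorem ae_prod_count_iff {X : Type*} [MeasurableSpace X] {μ : Measure X}
    {ι : Type*} [Fintype ι] [MeasurableSpace ι] [MeasurableSingletonClass ι] {p : X × ι → Prop} :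
    (∀ᵐ y ∂μ.prod Measure.count, p y) ↔ ∀ᵐ x ∂μ, ∀ i, p (x, i) := by
  constructor
  · intro h
    filter_upwards [Measure.ae_ae_of_ae_prod h] with x hx
    exact Measure.ae_count_iff.1 hx
  · intro h
    have h1 : μ {x | ¬ ∀ i, p (x, i)} = 0 := ae_iff.1 h
    refine measure_mono_null (t := {x | ¬ ∀ i, p (x, i)} ×ˢ Set.univ) ?_ ?_
    · rintro ⟨x, i⟩ hx
      exact ⟨fun h2 => hx (h2 i), trivial⟩
    · rw [Measure.prod_prod, h1, zero_mul]

theorem isGraphing_of_countable {X : Type*} [MeasurableSpace X] {μ : Measure X}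
    {G : SimpleGraph X} {ι : Type*} [Countable ι] [Nonempty ι] (A : ι → Set X) (f : ι → X → X)
    (hf : ∀ i, IsPmpPartialMap μ (A i) (f i))
    (hadj : ∀ x y, G.Adj x y ↔ ∃ i, x ∈ A i ∧ f i x = y) : IsGraphing G μ := by
  obtain ⟨q, hq⟩ := exists_surjective_nat ι
  refine ⟨A ∘ q, f ∘ q, fun i => hf _, fun x y => ?_⟩
  rw [hadj]
  exact hq.exists (p := fun i => x ∈ A i ∧ f i x = y)

variable {X : Type*} [MeasurableSpace X] {d : ℕ}

/-- Fixing the labels at both ends makes the vertex map injective; its invariance is that of `τ`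
tested on sets `S × {j}`. -/
theorem isPmpPartialMap_edgePerm {μ : Measure X} [SFinite μ] (τ : X × Fin d ≃ᵐ X × Fin d)
    (hτ : MeasurePreserving τ (μ.prod Measure.count) (μ.prod Measure.count)) (i j : Fin d) :
    IsPmpPartialMap μ {x | (τ (x, i)).2 = j} fun x => (τ (x, i)).1 := by
  have hm : Measurable fun x : X => τ (x, i) := τ.measurable.comp measurable_prodMk_right
  have hA : MeasurableSet {x | (τ (x, i)).2 = j} := hm.snd (measurableSet_singleton j)
  have himg : (fun x => (τ (x, i)).1) '' {x | (τ (x, i)).2 = j} =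
      {y | (τ.symm (y, j)).2 = i} := by
    ext y
    constructor
    · rintro ⟨x, hx, rfl⟩
      have : ((τ (x, i)).1, j) = τ (x, i) := by rw [← (hx : _ = j)]
      simp [this]
    · intro hy
      have h1 : ((τ.symm (y, j)).1, i) = τ.symm (y, j) := by rw [← (hy : _ = i)]
      exact ⟨(τ.symm (y, j)).1, by simp [h1], by simp [h1]⟩
  refine ⟨hA, ?_, hm.fst, ?_⟩
  · intro x hx x' hx' h
    have h1 : τ (x, i) = τ (x', i) := Prod.ext h ((hx : _ = j).trans (hx' : _ = j).symm)
    simpa using h1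
  · ext S hS
    have hB : MeasurableSet {y : X | (τ.symm (y, j)).2 = i} :=
      (τ.symm.measurable.comp measurable_prodMk_right).snd (measurableSet_singleton i)
    rw [himg, Measure.map_apply hm.fst hS, Measure.restrict_apply (hm.fst hS),
      Measure.restrict_apply hS]
    have key : τ ⁻¹' ((S ∩ {y | (τ.symm (y, j)).2 = i}) ×ˢ {j}) =
        (((fun x => (τ (x, i)).1) ⁻¹' S) ∩ {x | (τ (x, i)).2 = j}) ×ˢ {i} := by
      ext ⟨x, k⟩
      simp only [Set.mem_preimage, Set.mem_prod, Set.mem_inter_iff, Set.mem_ofPred_eq,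
        Set.mem_singleton_iff]
      constructor
      · rintro ⟨⟨h1, h2⟩, h3⟩
        have h4 : ((τ (x, k)).1, j) = τ (x, k) := by rw [← h3]
        rw [h4] at h2
        simp only [MeasurableEquiv.symm_apply_apply] at h2
        subst h2
        exact ⟨⟨h1, h3⟩, rfl⟩
      · rintro ⟨⟨h1, h3⟩, rfl⟩
        have h4 : ((τ (x, k)).1, j) = τ (x, k) := by rw [← h3]
        exact ⟨⟨h1, by simp [h4]⟩, h3⟩
    have h1 := hτ.measure_preimage ((hS.inter hB).prod (measurableSet_singleton j)).nullMeasurableSet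
    rw [key] at h1
    simpa [Measure.prod_prod] using h1

variable {μ : Measure X} {τ : X × Fin d ≃ᵐ X × Fin d}

theorem measurable_edgePermNeighbor (k : Fin d ⊕ Fin d) :
    Measurable fun x => edgePermNeighbor τ.toEquiv x k := by
  rcases k with i | i
  · exact (τ.measurable.comp measurable_prodMk_right).fst
  · exact (τ.symm.measurable.comp measurable_prodMk_right).fst

theorem isGraphing_edgePermGraph [SFinite μ] [NeZero d] (hs : IsSeparating τ.toEquiv)
    (hτ : MeasurePreserving τ (μ.prod Measure.count) (μ.prod Measure.count)) :
    IsGraphing (edgePermGraph τ.toEquiv) μ := by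
  have : Nonempty (Fin d) := ⟨0⟩
  refine isGraphing_of_countable (ι := (Fin d ⊕ Fin d) × Fin d)
    (fun k => Sum.elim (fun i => {x | (τ (x, i)).2 = k.2})
      (fun i => {x | (τ.symm (x, i)).2 = k.2}) k.1)
    (fun k x => edgePermNeighbor τ.toEquiv x k.1) ?_ ?_
  · rintro ⟨i | i, j⟩
    · exact isPmpPartialMap_edgePerm τ hτ i j
    · exact isPmpPartialMap_edgePerm τ.symm (hτ.symm τ) i j
  · intro x y
    rw [hs.adj_iff]
    constructor
    · rintro ⟨i | i, h⟩
      · exact ⟨(Sum.inl i, _), rfl, h⟩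
      · exact ⟨(Sum.inr i, _), rfl, h⟩
    · rintro ⟨⟨k, j⟩, -, h⟩
      exact ⟨k, h⟩

theorem measurableSet_edgePermGraph_adj [StandardBorelSpace X] (hs : IsSeparating τ.toEquiv) :
    MeasurableSet {e : X × X | (edgePermGraph τ.toEquiv).Adj e.1 e.2} := by
  simp_rw [hs.adj_iff, Set.ofPred_exists]
  exact MeasurableSet.iUnion fun k =>
    measurableSet_eq_fun ((measurable_edgePermNeighbor k).comp measurable_fst) measurable_snd

theorem measurableSet_edgePermOrientation [StandardBorelSpace X] :
    MeasurableSet (edgePermOrientation τ.toEquiv) := by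
  simp_rw [edgePermOrientation, Set.ofPred_exists]
  exact MeasurableSet.iUnion fun k =>
    measurableSet_eq_fun ((measurable_edgePermNeighbor (Sum.inl k)).comp measurable_fst)
      measurable_snd

theorem isBalancedOrientation_edgePerm [StandardBorelSpace X] (hs : IsSeparating τ.toEquiv) :
    IsBalancedOrientation (edgePermGraph τ.toEquiv) μ d (edgePermOrientation τ.toEquiv) := by
  refine ⟨measurableSet_edgePermOrientation, ?_, ?_, ?_⟩ <;> refine Filter.Eventually.of_forall ?_
  · intro x y hxy
    obtain ⟨i | i, rfl⟩ := hs.adj_iff.1 hxy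
    · exact Or.inl ⟨IsSeparating.mem_orientation_inl x i, hs.notMem_orientation_inl x i⟩
    · exact Or.inr ⟨IsSeparating.mem_orientation_inr x i, hs.notMem_orientation_inr x i⟩
  · intro x
    have : {y | (edgePermGraph τ.toEquiv).Adj x y ∧ (x, y) ∈ edgePermOrientation τ.toEquiv} =
        Set.range (edgePermNeighbor τ.toEquiv x ∘ Sum.inl) := by
      ext y
      constructor
      · rintro ⟨h1, h2⟩
        obtain ⟨i | i, rfl⟩ := hs.adj_iff.1 h1
        · exact ⟨i, rfl⟩
        · exact (hs.notMem_orientation_inr x i h2).elim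
      · rintro ⟨i, rfl⟩
        exact ⟨hs.adj_iff.2 ⟨_, rfl⟩, IsSeparating.mem_orientation_inl x i⟩
    rw [this, ← Set.image_univ,
      ((hs.neighbor_injective x).comp Sum.inl_injective).encard_image, Set.encard_univ]
    simp
  · intro x
    have : {y | (edgePermGraph τ.toEquiv).Adj x y ∧ (y, x) ∈ edgePermOrientation τ.toEquiv} =
        Set.range (edgePermNeighbor τ.toEquiv x ∘ Sum.inr) := by
      ext y
      constructor
      · rintro ⟨h1, h2⟩
        obtain ⟨i | i, rfl⟩ := hs.adj_iff.1 h1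
        · exact (hs.notMem_orientation_inl x i h2).elim
        · exact ⟨i, rfl⟩
      · rintro ⟨i, rfl⟩
        exact ⟨hs.adj_iff.2 ⟨_, rfl⟩, IsSeparating.mem_orientation_inr x i⟩
    rw [this, ← Set.image_univ,
      ((hs.neighbor_injective x).comp Sum.inr_injective).encard_image, Set.encard_univ]
    simp

/-- Replaces the edge measure by vertices with `2d` neighbour slots. As `p` need not be measurable,
the exceptional sets are enlarged to measurable hulls. -/
theorem ae_edgeMeasure_iff [StandardBorelSpace X] [SFinite μ] [NeZero d]
    (hs : IsSeparating τ.toEquiv)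
    (hτ : MeasurePreserving τ (μ.prod Measure.count) (μ.prod Measure.count)) {p : X × X → Prop} :
    (∀ᵐ e ∂edgeMeasure (edgePermGraph τ.toEquiv) μ (2 * d), p e) ↔
      ∀ᵐ x ∂μ, ∀ k, p (x, edgePermNeighbor τ.toEquiv x k) := by
  have hG := isGraphing_edgePermGraph hs hτ
  have hmeas : ∀ {S : Set (X × X)}, MeasurableSet S → Measurable fun x =>
      ({y | (edgePermGraph τ.toEquiv).Adj x y ∧ (x, y) ∈ S}.encard : ℝ≥0∞) := by
    intro S hS
    simp_rw [← outMeasure_apply hG _ hS]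
    exact (Measure.measurable_coe hS).comp (measurable_outMeasure hG)
  constructor
  · intro h
    set T := toMeasurable (edgeMeasure (edgePermGraph τ.toEquiv) μ (2 * d)) {e | ¬ p e} with hT
    have h1 : edgeMeasure (edgePermGraph τ.toEquiv) μ (2 * d) T = 0 := by
      rw [hT, measure_toMeasurable]
      exact ae_iff.1 h
    rw [edgeMeasure_apply hG _ (measurableSet_toMeasurable _ _), mul_eq_zero,
      lintegral_eq_zero_iff (hmeas (measurableSet_toMeasurable _ _))] at h1
    have h2 := h1.resolve_left (ENNReal.inv_ne_zero.2 (ENNReal.natCast_ne_top _))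
    filter_upwards [h2] with x hx k
    by_contra hk
    simp only [Pi.zero_apply] at hx
    have h3 : {y | (edgePermGraph τ.toEquiv).Adj x y ∧ (x, y) ∈ T} = ∅ := by
      rw [← Set.encard_eq_zero]
      exact_mod_cast hx
    have h4 : edgePermNeighbor τ.toEquiv x k ∈
        {y | (edgePermGraph τ.toEquiv).Adj x y ∧ (x, y) ∈ T} :=
      ⟨hs.adj_iff.2 ⟨k, rfl⟩, subset_toMeasurable _ _ hk⟩
    rw [h3] at h4
    exact h4
  · intro h
    set N := toMeasurable μ {x | ¬ ∀ k, p (x, edgePermNeighbor τ.toEquiv x k)} with hN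
    have hN0 : μ N = 0 := by
      rw [hN, measure_toMeasurable]
      exact ae_iff.1 h
    -- The non-edges are included because `p` is unrestricted there; the edge measure does not see
    -- them.
    have hT : MeasurableSet (Prod.fst ⁻¹' N ∪
        {e : X × X | (edgePermGraph τ.toEquiv).Adj e.1 e.2}ᶜ) :=
      (measurable_fst (measurableSet_toMeasurable _ _)).union
        (measurableSet_edgePermGraph_adj hs).compl
    refine measure_mono_null (t := Prod.fst ⁻¹' N ∪
        {e : X × X | (edgePermGraph τ.toEquiv).Adj e.1 e.2}ᶜ) ?_ ?_
    · rintro ⟨x, y⟩ hxy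
      by_contra hcon
      simp only [Set.mem_union, Set.mem_preimage, Set.mem_compl_iff, Set.mem_ofPred_eq,
        not_or, not_not] at hcon
      obtain ⟨k, rfl⟩ := hs.adj_iff.1 hcon.2
      exact hcon.1 (subset_toMeasurable _ _ fun h5 => hxy (h5 k))
    · rw [edgeMeasure_apply hG _ hT, mul_eq_zero, lintegral_eq_zero_iff (hmeas hT)]
      right
      have h6 : ∀ᵐ x ∂μ, x ∉ N := measure_eq_zero_iff_ae_notMem.1 hN0
      filter_upwards [h6] with x hx
      have : {y | (edgePermGraph τ.toEquiv).Adj x y ∧ (x, y) ∈ Prod.fst ⁻¹' N ∪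
          {e : X × X | (edgePermGraph τ.toEquiv).Adj e.1 e.2}ᶜ} = ∅ := by
        ext y
        simp +contextual [hx]
      rw [this]
      simp

/-- Pulls L² functions on directed edges back to `X × Fin d`. Only an inequality, since the
`τ`-edges are half of the directed edges. -/
theorem map_source_target_le [StandardBorelSpace X] [SFinite μ] [NeZero d]
    (hs : IsSeparating τ.toEquiv)
    (hτ : MeasurePreserving τ (μ.prod Measure.count) (μ.prod Measure.count)) :
    (μ.prod Measure.count).map (fun y => (y.1, (τ y).1)) ≤
      ((2 * d : ℕ) : ℝ≥0∞) • edgeMeasure (edgePermGraph τ.toEquiv) μ (2 * d) := by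
  have hm : Measurable fun y : X × Fin d => (y.1, (τ y).1) :=
    measurable_fst.prodMk τ.measurable.fst
  refine Measure.le_iff.2 fun S hS => ?_
  rw [Measure.map_apply hm hS, Measure.smul_apply,
    edgeMeasure_apply (isGraphing_edgePermGraph hs hτ) _ hS, smul_eq_mul, ← mul_assoc,
    ENNReal.mul_inv_cancel (by simp [NeZero.ne d]) (ENNReal.natCast_ne_top _), one_mul,
    Measure.prod_apply (hm hS)]
  refine lintegral_mono fun x => ?_
  rw [Measure.count_apply (measurable_prodMk_left (hm hS))]
  have hinj : Function.Injective fun i => edgePermNeighbor τ.toEquiv x (Sum.inl i) :=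
    (hs.neighbor_injective x).comp Sum.inl_injective
  rw [← hinj.encard_image]
  refine ENat.toENNReal_mono (Set.encard_le_encard ?_)
  rintro _ ⟨i, hi, rfl⟩
  exact ⟨hs.adj_iff.2 ⟨_, rfl⟩, hi⟩

theorem isFiniteMeasure_edgeMeasure [StandardBorelSpace X] [IsProbabilityMeasure μ] [NeZero d]
    (hs : IsSeparating τ.toEquiv)
    (hτ : MeasurePreserving τ (μ.prod Measure.count) (μ.prod Measure.count)) :
    IsFiniteMeasure (edgeMeasure (edgePermGraph τ.toEquiv) μ (2 * d)) := by
  refine ⟨?_⟩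
  rw [edgeMeasure_apply (isGraphing_edgePermGraph hs hτ) _ MeasurableSet.univ]
  have h1 : ∀ x, {y | (edgePermGraph τ.toEquiv).Adj x y ∧ (x, y) ∈ Set.univ}.encard
      = (2 * d : ℕ) := fun x => by
    rw [← hs.isRegularGraph x]
    congr 1
    ext y
    simp
  simp_rw [h1]
  have hd : 0 < d := Nat.pos_of_ne_zero (NeZero.ne d)
  simp [ENNReal.mul_lt_top_iff, hd]

end EdgePermutationMeasure

/-! ### Circulations under uniqueness of flows -/

section UniqueFlow

/-- Every square integrable edge function that is conserved at almost every vertex is constant. -/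
def HasUniqueFlow {X : Type*} [MeasurableSpace X] {d : ℕ} (μ : Measure X)
    (τ : X × Fin d ≃ X × Fin d) : Prop :=
  ∀ g : X × Fin d → ℝ, MemLp g 2 (μ.prod Measure.count) →
    (∀ᵐ x ∂μ, ∑ i, g (x, i) = ∑ i, g (τ.symm (x, i))) →
    ∃ c : ℝ, g =ᵐ[μ.prod Measure.count] fun _ => c

theorem signedIndicator_swap {X : Type*} (S : Set (X × X)) (e : X × X) :
    signedIndicator S e.swap = -signedIndicator S e := by
  simp [signedIndicator]

theorem measurable_signedIndicator {X : Type*} [MeasurableSpace X] {S : Set (X × X)}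
    (hS : MeasurableSet S) : Measurable (signedIndicator S) :=
  (measurable_one.indicator hS).sub ((measurable_one.indicator hS).comp measurable_swap)

theorem abs_signedIndicator_le {X : Type*} (S : Set (X × X)) (e : X × X) :
    |signedIndicator S e| ≤ 1 := by
  classical
  simp only [signedIndicator, Set.indicator_apply, Pi.one_apply]
  split_ifs <;> simp

/-- The vertex `x` has either no edge of `S` or exactly one outgoing and one incoming
edge of `S`. -/
def IsPathLikeAt {X : Type*} (G : SimpleGraph X) (S : Set (X × X)) (x : X) : Prop :=
  (∀ y, G.Adj x y → (x, y) ∉ S ∧ (y, x) ∉ S) ∨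
    ∃ u v, G.Adj x u ∧ G.Adj x v ∧
      ∀ y, G.Adj x y → ((x, y) ∈ S ↔ y = u) ∧ ((y, x) ∈ S ↔ y = v)

theorem IsPathLikeAt.finsum_signedIndicator {X : Type*} {G : SimpleGraph X} {S : Set (X × X)}
    {x : X} (h : IsPathLikeAt G S x) (hfin : (G.neighborSet x).Finite) :
    ∑ᶠ y ∈ G.neighborSet x, signedIndicator S (x, y) = 0 := by
  classical
  rcases h with h | ⟨u, v, hu, hv, h⟩
  · refine finsum_mem_eq_zero_of_forall_eq_zero fun y hy => ?_
    obtain ⟨h1, h2⟩ := h y hy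
    simp [signedIndicator, h1, h2]
  · rw [finsum_mem_eq_finite_toFinset_sum _ hfin]
    have h1 : ∀ y ∈ hfin.toFinset, signedIndicator S (x, y) =
        (if y = u then 1 else 0) - if y = v then 1 else 0 := by
      intro y hy
      obtain ⟨h2, h3⟩ := h y (by simpa using hy)
      simp [signedIndicator, Set.indicator_apply, h2, h3]
    rw [Finset.sum_congr rfl h1, Finset.sum_sub_distrib, Finset.sum_ite_eq', Finset.sum_ite_eq',
      if_pos (by simpa using hu), if_pos (by simpa using hv), sub_self]

theorem IsSeparating.finsum_neighborSet {X : Type*} [MeasurableSpace X] {d : ℕ}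
    {τ : X × Fin d ≃ᵐ X × Fin d} (hs : IsSeparating τ.toEquiv) (f : X × X → ℝ) (x : X) :
    ∑ᶠ y ∈ (edgePermGraph τ.toEquiv).neighborSet x, f (x, y) =
      ∑ i, f (x, (τ (x, i)).1) + ∑ i, f (x, (τ.symm (x, i)).1) := by
  rw [hs.neighborSet_eq, finsum_mem_range (hs.neighbor_injective x), finsum_eq_sum_of_fintype,
    Fintype.sum_sum_type]
  rfl

variable {X : Type*} [MeasurableSpace X] [StandardBorelSpace X] {d : ℕ} [NeZero d]
  {μ : Measure X} [IsProbabilityMeasure μ] {τ : X × Fin d ≃ᵐ X × Fin d}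

theorem ae_edgeMeasure_swap (hs : IsSeparating τ.toEquiv)
    (hτ : MeasurePreserving τ (μ.prod Measure.count) (μ.prod Measure.count)) {p : X × X → Prop}
    (h : ∀ᵐ e ∂edgeMeasure (edgePermGraph τ.toEquiv) μ (2 * d), p e) :
    ∀ᵐ e ∂edgeMeasure (edgePermGraph τ.toEquiv) μ (2 * d), p e.swap := by
  rw [ae_edgeMeasure_iff hs hτ] at h ⊢
  have h1 : ∀ᵐ y ∂μ.prod (Measure.count : Measure (Fin d)), p (y.1, (τ y).1) :=
    ae_prod_count_iff.2 (h.mono fun x hx i => hx (Sum.inl i))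
  have h2 : ∀ᵐ y ∂μ.prod (Measure.count : Measure (Fin d)), p (y.1, (τ.symm y).1) :=
    ae_prod_count_iff.2 (h.mono fun x hx i => hx (Sum.inr i))
  filter_upwards [ae_prod_count_iff.1 ((hτ.symm τ).quasiMeasurePreserving.ae h1),
    ae_prod_count_iff.1 (hτ.quasiMeasurePreserving.ae h2)] with x h3 h4
  rintro (i | i)
  · simpa [edgePermNeighbor] using h4 i
  · simpa [edgePermNeighbor] using h3 i

/-- Read `f` in the direction of `τ`: antisymmetry turns the vanishing of the sum at a vertex into
equality of outflow and inflow, so the flow is constant. Antisymmetry also gives the values against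
the direction of `τ`. -/
theorem isCirculation_iff (hs : IsSeparating τ.toEquiv)
    (hτ : MeasurePreserving τ (μ.prod Measure.count) (μ.prod Measure.count))
    (hu : HasUniqueFlow μ τ.toEquiv) (f : X × X → ℝ)
    (hf : MemLp f 2 (edgeMeasure (edgePermGraph τ.toEquiv) μ (2 * d))) :
    IsCirculation (edgePermGraph τ.toEquiv) μ (2 * d) f ↔
      ∃ c : ℝ, f =ᵐ[edgeMeasure (edgePermGraph τ.toEquiv) μ (2 * d)]
        fun e => c * signedIndicator (edgePermOrientation τ.toEquiv) e := by
  constructor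
  · rintro ⟨hanti, hcons⟩
    rw [ae_edgeMeasure_iff hs hτ] at hanti
    have hg : MemLp (fun y : X × Fin d => f (y.1, (τ y).1)) 2 (μ.prod Measure.count) := by
      have hm : Measurable fun y : X × Fin d => (y.1, (τ y).1) :=
        measurable_fst.prodMk τ.measurable.fst
      exact MemLp.comp_of_map (MemLp.mono_measure (map_source_target_le hs hτ)
        (hf.smul_measure (ENNReal.natCast_ne_top _))) hm.aemeasurable
    have hc : ∀ᵐ x ∂μ, ∑ i, f (x, (τ (x, i)).1) =
        ∑ i, f ((τ.symm (x, i)).1, (τ (τ.symm (x, i))).1) := by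
      filter_upwards [hanti, hcons] with x h1 h2
      rw [hs.finsum_neighborSet] at h2
      have h3 : ∀ i, f ((τ.symm (x, i)).1, (τ (τ.symm (x, i))).1) = -f (x, (τ.symm (x, i)).1) := by
        intro i
        rw [τ.apply_symm_apply]
        exact h1 (Sum.inr i)
      simp_rw [h3, Finset.sum_neg_distrib]
      linarith
    obtain ⟨c, hc⟩ := hu _ hg hc
    refine ⟨c, (ae_edgeMeasure_iff hs hτ).2 ?_⟩
    have hc' := ae_prod_count_iff.1 ((hτ.symm τ).quasiMeasurePreserving.ae hc)
    filter_upwards [ae_prod_count_iff.1 hc, hc', hanti] with x h1 h2 h3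
    rintro (i | i)
    · rw [hs.signedIndicator_inl, mul_one]
      exact h1 i
    · rw [hs.signedIndicator_inr, mul_neg, mul_one]
      have h4 := h3 (Sum.inr i)
      have h5 := h2 i
      simp only [MeasurableEquiv.apply_symm_apply] at h5
      have h6 : f (edgePermNeighbor τ.toEquiv x (Sum.inr i), x) = c := h5
      simp only [Prod.swap_prod_mk, h6] at h4
      linarith
  · rintro ⟨c, hc⟩
    refine ⟨?_, ?_⟩
    · filter_upwards [hc, ae_edgeMeasure_swap hs hτ hc] with e h1 h2
      rw [h1, h2, signedIndicator_swap, mul_neg]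
    · filter_upwards [(ae_edgeMeasure_iff hs hτ).1 hc] with x hx
      have h1 : ∀ i, f (x, (τ (x, i)).1) = c := fun i => by
        have := hx (Sum.inl i)
        rwa [hs.signedIndicator_inl, mul_one] at this
      have h2 : ∀ i, f (x, (τ.symm (x, i)).1) = -c := fun i => by
        have := hx (Sum.inr i)
        rwa [hs.signedIndicator_inr, mul_neg, mul_one] at this
      rw [hs.finsum_neighborSet]
      simp [h1, h2]

theorem signedIndicator_ae_eq_zero (hd : 2 ≤ d) (hs : IsSeparating τ.toEquiv)
    (hτ : MeasurePreserving τ (μ.prod Measure.count) (μ.prod Measure.count))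
    (hu : HasUniqueFlow μ τ.toEquiv) {S : Set (X × X)} (hS : MeasurableSet S)
    (hpath : ∀ᵐ x ∂μ, IsPathLikeAt (edgePermGraph τ.toEquiv) S x) :
    ∀ᵐ e ∂edgeMeasure (edgePermGraph τ.toEquiv) μ (2 * d), signedIndicator S e = 0 := by
  classical
  have := isFiniteMeasure_edgeMeasure (μ := μ) hs hτ
  have hfin : ∀ x, ((edgePermGraph τ.toEquiv).neighborSet x).Finite := fun x => by
    rw [hs.neighborSet_eq]
    exact Set.finite_range _
  obtain ⟨c, hc⟩ := (isCirculation_iff hs hτ hu (signedIndicator S)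
    (MemLp.of_bound (measurable_signedIndicator hS).aestronglyMeasurable 1
      (Filter.Eventually.of_forall fun e => abs_signedIndicator_le S e))).1
    ⟨Filter.Eventually.of_forall (signedIndicator_swap S),
      hpath.mono fun x hx => hx.finsum_signedIndicator (hfin x)⟩
  -- The constant `c` is global, so one generic vertex decides.
  obtain ⟨x, hx, hcx⟩ := (hpath.and ((ae_edgeMeasure_iff hs hτ).1 hc)).exists
  have hzero : ∃ k, signedIndicator S (x, edgePermNeighbor τ.toEquiv x k) = 0 := by
    rcases hx with h | ⟨u, v, -, -, h⟩
    · obtain ⟨h1, h2⟩ := h _ (hs.adj_iff.2 ⟨Sum.inl 0, rfl⟩)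
      exact ⟨Sum.inl 0, by simp [signedIndicator, h1, h2]⟩
    · have hcard : ({u, v} : Finset X).card <
          (Finset.univ.image (edgePermNeighbor τ.toEquiv x)).card := by
        rw [Finset.card_image_of_injective _ (hs.neighbor_injective x)]
        refine Finset.card_le_two.trans_lt ?_
        simp
        omega
      obtain ⟨y, hy, hyuv⟩ := Finset.exists_mem_notMem_of_card_lt_card hcard
      obtain ⟨k, -, rfl⟩ := Finset.mem_image.1 hy
      obtain ⟨h1, h2⟩ := h _ (hs.adj_iff.2 ⟨k, rfl⟩)
      simp only [Finset.mem_insert, Finset.mem_singleton, not_or] at hyuv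
      exact ⟨k, by simp [signedIndicator, h1, h2, hyuv]⟩
  obtain ⟨k, hk⟩ := hzero
  have h1 := hcx k
  rw [hk] at h1
  have h2 : c = 0 := by
    simpa [hs.signedIndicator_ne_zero x k] using h1.symm
  filter_upwards [hc] with e he
  rw [he, h2, zero_mul]

end UniqueFlow

/-! ### Nonexistence of path-cycle decompositions, decorations and free actions -/

section Consequences

/-- Replaces injectivity on cycles, where a vertex determines its index only modulo the length. -/
theorem IsPathOrCycle.succ_eq {X : Type*} {G : SimpleGraph X} {p : ℤ → X} (hp : IsPathOrCycle G p)
    {j k : ℤ} (h : p j = p k) (l : ℤ) : p (j + l) = p (k + l) := by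
  rcases hp.2 with hinj | ⟨m, -, hm⟩
  · rw [hinj h]
  · rw [hm] at h ⊢
    simpa using h

theorem IsPathCycleSystem.isPathLikeAt {X : Type*} {G : SimpleGraph X} {P : Set (X × X)}
    (hP : IsPathCycleSystem G P) (x : X) : IsPathLikeAt G P x := by
  obtain ⟨C, hC, hdisj, rfl⟩ := hP
  by_cases hx : ∃ p ∈ C, ∃ n : ℤ, p n = x
  · right
    obtain ⟨p, hp, n, rfl⟩ := hx
    have huniq : ∀ q ∈ C, ∀ k : ℤ, q k = p n → q = p := by
      intro q hq k hk
      by_contra hne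
      exact Set.disjoint_left.1 (hdisj hq hp hne) ⟨k, rfl⟩ (hk ▸ ⟨n, rfl⟩)
    refine ⟨p (n + 1), p (n + -1), (hC p hp).1 n, ?_, fun y _ => ⟨⟨?_, ?_⟩, ⟨?_, ?_⟩⟩⟩
    · have := ((hC p hp).1 (n + -1)).symm
      simpa using this
    · rintro ⟨q, hq, k, hk⟩
      simp only [Prod.mk.injEq] at hk
      obtain rfl := huniq q hq k hk.1.symm
      rw [hk.2]
      exact (hC q hq).succ_eq hk.1.symm 1
    · rintro rfl
      exact ⟨p, hp, n, rfl⟩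
    · rintro ⟨q, hq, k, hk⟩
      simp only [Prod.mk.injEq] at hk
      obtain rfl := huniq q hq _ hk.2.symm
      rw [hk.1]
      have := (hC q hq).succ_eq hk.2.symm (-1)
      simpa using this
    · rintro rfl
      exact ⟨p, hp, n + -1, by simp⟩
  · left
    push Not at hx
    intro y _
    constructor
    · rintro ⟨p, hp, n, h⟩
      simp only [Prod.mk.injEq] at h
      exact hx p hp n h.1.symm
    · rintro ⟨p, hp, n, h⟩
      simp only [Prod.mk.injEq] at h
      exact hx p hp _ h.2.symm

variable {X : Type*} [MeasurableSpace X] [StandardBorelSpace X] {d : ℕ} [NeZero d]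
  {μ : Measure X} [IsProbabilityMeasure μ] {τ : X × Fin d ≃ᵐ X × Fin d}

/-- Each member of the family carries the zero function almost everywhere; by Fubini almost every
edge sees zero for almost all parameters, so the integral is `0` where it should be `±1`. -/
theorem not_decomposesIntoPathsAndCycles (hd : 2 ≤ d) (hs : IsSeparating τ.toEquiv)
    (hτ : MeasurePreserving τ (μ.prod Measure.count) (μ.prod Measure.count))
    (hu : HasUniqueFlow μ τ.toEquiv) :
    ¬ DecomposesIntoPathsAndCycles (edgePermGraph τ.toEquiv) μ (2 * d)
      (signedIndicator (edgePermOrientation τ.toEquiv)) := by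
  rintro ⟨Ω, _, ν, _, P, hPm, hP, hint⟩
  have := isFiniteMeasure_edgeMeasure (μ := μ) hs hτ
  have hmeas : ∀ w, MeasurableSet (P w) := fun w => measurable_prodMk_left hPm
  have h0 : ∀ w, ∀ᵐ e ∂edgeMeasure (edgePermGraph τ.toEquiv) μ (2 * d),
      signedIndicator (P w) e = 0 := fun w =>
    signedIndicator_ae_eq_zero hd hs hτ hu (hmeas w)
      (Filter.Eventually.of_forall (hP w).isPathLikeAt)
  have hjoint : Measurable fun q : Ω × (X × X) => signedIndicator (P q.1) q.2 := by
    have h1 : Measurable ({q : Ω × (X × X) | q.2 ∈ P q.1}.indicator (1 : Ω × (X × X) → ℝ)) :=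
      measurable_one.indicator hPm
    have h2 : Measurable fun q : Ω × (X × X) => (q.1, q.2.swap) :=
      measurable_fst.prodMk (measurable_swap.comp measurable_snd)
    exact h1.sub (h1.comp h2)
  have h1 : ∀ᵐ q ∂ν.prod (edgeMeasure (edgePermGraph τ.toEquiv) μ (2 * d)),
      signedIndicator (P q.1) q.2 = 0 := by
    have hset : MeasurableSet {q : Ω × (X × X) | ¬ signedIndicator (P q.1) q.2 = 0} :=
      (hjoint (measurableSet_singleton 0)).compl
    rw [ae_iff, Measure.measure_prod_null hset]
    exact Filter.Eventually.of_forall fun w => ae_iff.1 (h0 w)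
  have h2 : ∀ᵐ e ∂edgeMeasure (edgePermGraph τ.toEquiv) μ (2 * d), ∀ᵐ w ∂ν,
      signedIndicator (P w) e = 0 :=
    Measure.ae_ae_of_ae_prod
      (Measure.measurePreserving_swap.quasiMeasurePreserving.ae h1)
  have h3 := (ae_edgeMeasure_iff hs hτ).1 (h2.and hint)
  obtain ⟨x, hx⟩ := h3.exists
  obtain ⟨h4, -, h5⟩ := hx (Sum.inl 0)
  rw [integral_congr_ae (h4 : _ =ᵐ[ν] fun _ => (0 : ℝ)), integral_zero] at h5
  exact hs.signedIndicator_ne_zero x _ h5.symm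

/-- One label class has one outgoing and one incoming edge at almost every vertex, so it would carry
zero; yet its function is `1` on its edges, whose reversals are not in the orientation. -/
theorem not_isSchreierDecoration (hd : 2 ≤ d) (hs : IsSeparating τ.toEquiv)
    (hτ : MeasurePreserving τ (μ.prod Measure.count) (μ.prod Measure.count))
    (hu : HasUniqueFlow μ τ.toEquiv) :
    ¬ ∃ (O' : Set (X × X)) (c : X × X → Fin d),
      IsSchreierDecoration (edgePermGraph τ.toEquiv) μ d O' c := by
  rintro ⟨O, c, hOc⟩
  have hS : MeasurableSet (O ∩ c ⁻¹' {0}) :=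
    hOc.balanced.measurableSet.inter (hOc.measurable (measurableSet_singleton 0))
  have h0 := signedIndicator_ae_eq_zero hd hs hτ hu hS (by
    filter_upwards [hOc.out_label, hOc.in_label] with x h1 h2
    obtain ⟨u, ⟨hu1, hu2⟩, hu3⟩ := h1 0
    obtain ⟨v, ⟨hv1, hv2⟩, hv3⟩ := h2 0
    refine Or.inr ⟨u, v, hu1, hv1, fun y hy => ⟨⟨fun h => hu3 y ⟨hy, h⟩, ?_⟩,
      ⟨fun h => hv3 y ⟨hy, h⟩, ?_⟩⟩⟩
    · rintro rfl
      exact hu2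
    · rintro rfl
      exact hv2)
  obtain ⟨x, h1, h2, h3⟩ := (((ae_edgeMeasure_iff hs hτ).1 h0).and
    (hOc.out_label.and hOc.balanced.orients)).exists
  obtain ⟨u, ⟨hu1, hu2⟩, -⟩ := h2 0
  have h4 : (u, x) ∉ O := by
    rcases h3 u hu1 with h | h
    · exact h.2
    · exact fun _ => h.2 hu2.1
  obtain ⟨k, rfl⟩ := hs.adj_iff.1 hu1
  have h5 := h1 k
  simp [signedIndicator, h4, hu2] at h5

theorem not_isGeneratedByFreeAction (hd : 2 ≤ d) (hs : IsSeparating τ.toEquiv)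
    (hτ : MeasurePreserving τ (μ.prod Measure.count) (μ.prod Measure.count))
    (hu : HasUniqueFlow μ τ.toEquiv) :
    ¬ IsGeneratedByFreeAction (edgePermGraph τ.toEquiv) μ d := by
  rintro ⟨_, hmeas, hfree, hadj⟩
  set γ : FreeGroup (Fin d) := FreeGroup.of 0 with hγ
  -- If `γ • γ • x = x`, the edge from `x` to `γ • x` would cancel against its reversal. The
  -- exponent sum homomorphism to `ℤ` shows that `γ` has no order two.
  have hγγ : γ * γ ≠ 1 := by
    rw [hγ, ← pow_two]
    intro h
    have h1 := congrArg (FreeGroup.lift fun _ : Fin d => Multiplicative.ofAdd (1 : ℤ)) h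
    rw [map_pow, FreeGroup.lift_apply_of, MonoidHom.map_one, ← ofAdd_nsmul] at h1
    have h2 : (2 • (1 : ℤ)) = 0 := h1
    norm_num at h2
  have hS : MeasurableSet {e : X × X | γ • e.1 = e.2} :=
    measurableSet_eq_fun ((hmeas γ).comp measurable_fst) measurable_snd
  have h0 := signedIndicator_ae_eq_zero hd hs hτ hu hS (by
    filter_upwards [hadj] with x hx
    refine Or.inr ⟨γ • x, γ⁻¹ • x, (hx _).2 ⟨0, Or.inl rfl⟩, (hx _).2 ⟨0, Or.inr rfl⟩,
      fun y _ => ⟨eq_comm, ?_⟩⟩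
    exact smul_eq_iff_eq_inv_smul γ)
  obtain ⟨x, h1, h2, h3⟩ := (((ae_edgeMeasure_iff hs hτ).1 h0).and (hfree.and hadj)).exists
  obtain ⟨k, hk⟩ := hs.adj_iff.1 ((h3 (γ • x)).2 ⟨0, Or.inl rfl⟩)
  have h4 := h1 k
  rw [hk] at h4
  have h5 : γ • γ • x ≠ x := by
    rw [smul_smul]
    exact h2 _ hγγ
  simp [signedIndicator, h5] at h4

end Consequences

/-! ### Passing to an invariant conull set -/

section Restriction

variable {X : Type} [MeasurableSpace X] {d : ℕ}

/-- A conull set of edges contains the full edge set over a conull, `τ`-invariant set of vertices. -/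
theorem exists_invariant_conull {μ : Measure X} (τ : X × Fin d ≃ᵐ X × Fin d)
    (hτ : MeasurePreserving τ (μ.prod Measure.count) (μ.prod Measure.count))
    {Y : Set (X × Fin d)} (hY : MeasurableSet Y) (hYae : ∀ᵐ y ∂μ.prod Measure.count, y ∈ Y) :
    ∃ A : Set X, MeasurableSet A ∧ (∀ᵐ x ∂μ, x ∈ A) ∧ (∀ x ∈ A, ∀ i, (x, i) ∈ Y) ∧
      (∀ y : X × Fin d, y.1 ∈ A → (τ y).1 ∈ A) ∧ ∀ y : X × Fin d, y.1 ∈ A → (τ.symm y).1 ∈ A := by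
  -- Each step discards the vertices with a neighbour outside the current set; the intersection of
  -- all stages is invariant.
  let step : Set X → Set X := fun A =>
    A ∩ ({x | ∀ i, (τ (x, i)).1 ∈ A} ∩ {x | ∀ i, (τ.symm (x, i)).1 ∈ A})
  let Z : ℕ → Set X := fun k => step^[k] {x | ∀ i, (x, i) ∈ Y}
  have hZ : ∀ k, Z (k + 1) = step (Z k) := fun k => Function.iterate_succ_apply' _ _ _
  have hm : ∀ k, MeasurableSet (Z k) := by
    intro k
    induction k with
    | zero =>
      refine MeasurableSet.congr (MeasurableSet.iInter fun i => measurable_prodMk_right (y := i) hY) ?_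
      ext x
      simp [Z]
    | succ k ih =>
      rw [hZ]
      refine ih.inter (MeasurableSet.inter ?_ ?_)
      · rw [Set.ofPred_forall]
        exact MeasurableSet.iInter fun i => (τ.measurable.comp measurable_prodMk_right).fst ih
      · rw [Set.ofPred_forall]
        exact MeasurableSet.iInter fun i => (τ.symm.measurable.comp measurable_prodMk_right).fst ih
  have hae : ∀ k, ∀ᵐ x ∂μ, x ∈ Z k := by
    intro k
    induction k with
    | zero => exact ae_prod_count_iff.1 hYae
    | succ k ih =>
      rw [hZ]
      have h1 : ∀ᵐ y ∂μ.prod (Measure.count : Measure (Fin d)), y.1 ∈ Z k :=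
        ae_prod_count_iff.2 (ih.mono fun x hx _ => hx)
      filter_upwards [ih, ae_prod_count_iff.1 (hτ.quasiMeasurePreserving.ae h1),
        ae_prod_count_iff.1 ((hτ.symm τ).quasiMeasurePreserving.ae h1)] with x h2 h3 h4
      exact ⟨h2, h3, h4⟩
  refine ⟨⋂ k, Z k, MeasurableSet.iInter hm, ?_, ?_, ?_, ?_⟩
  · simpa only [Set.mem_iInter] using ae_all_iff.2 hae
  · exact fun x hx => Set.mem_iInter.1 hx 0
  · intro y hy
    refine Set.mem_iInter.2 fun k => ?_
    have h1 := Set.mem_iInter.1 hy (k + 1)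
    rw [hZ] at h1
    exact h1.2.1 y.2
  · intro y hy
    refine Set.mem_iInter.2 fun k => ?_
    have h1 := Set.mem_iInter.1 hy (k + 1)
    rw [hZ] at h1
    exact h1.2.2 y.2

/-- The restriction of `τ` to the edges over an invariant set of vertices. -/
def edgePermRestrict (τ : X × Fin d ≃ᵐ X × Fin d) (A : Set X)
    (h1 : ∀ y : X × Fin d, y.1 ∈ A → (τ y).1 ∈ A)
    (h2 : ∀ y : X × Fin d, y.1 ∈ A → (τ.symm y).1 ∈ A) : A × Fin d ≃ᵐ A × Fin d where
  toFun y := (⟨(τ (y.1.1, y.2)).1, h1 _ y.1.2⟩, (τ (y.1.1, y.2)).2)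
  invFun y := (⟨(τ.symm (y.1.1, y.2)).1, h2 _ y.1.2⟩, (τ.symm (y.1.1, y.2)).2)
  left_inv y := by simp
  right_inv y := by simp
  measurable_toFun := by
    have h : Measurable fun y : A × Fin d => τ (y.1.1, y.2) :=
      τ.measurable.comp ((measurable_subtype_coe.comp measurable_fst).prodMk measurable_snd)
    exact h.fst.subtype_mk.prodMk h.snd
  measurable_invFun := by
    have h : Measurable fun y : A × Fin d => τ.symm (y.1.1, y.2) :=
      τ.symm.measurable.comp ((measurable_subtype_coe.comp measurable_fst).prodMk measurable_snd)
    exact h.fst.subtype_mk.prodMk h.snd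

/-- Separation holds at first only for edges in a conull set; the restriction makes it, and so
acyclicity and regularity, hold everywhere. A flow on the restriction is extended by zero to
transfer uniqueness. -/
theorem exists_separating_restriction [StandardBorelSpace X] {μ : Measure X}
    [IsProbabilityMeasure μ] (τ : X × Fin d ≃ᵐ X × Fin d)
    (hτ : MeasurePreserving τ (μ.prod Measure.count) (μ.prod Measure.count))
    (hu : HasUniqueFlow μ τ.toEquiv)
    {Y : Set (X × Fin d)} (hY : MeasurableSet Y) (hYae : ∀ᵐ y ∂μ.prod Measure.count, y ∈ Y)
    (hsep : ∀ F : Finset (X × Fin d), (∀ y ∈ F, y ∈ Y) → ∀ y₀ ∈ Y, ∃ ψ : X → ℕ,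
      ψ (τ y₀).1 ≠ ψ y₀.1 ∧ ∀ y ∈ F, y ≠ y₀ → ψ (τ y).1 = ψ y.1) :
    ∃ (X' : Type) (_ : MeasurableSpace X') (_ : StandardBorelSpace X') (μ' : Measure X')
      (_ : IsProbabilityMeasure μ') (τ' : X' × Fin d ≃ᵐ X' × Fin d),
      MeasurePreserving τ' (μ'.prod Measure.count) (μ'.prod Measure.count) ∧
      IsSeparating τ'.toEquiv ∧ HasUniqueFlow μ' τ'.toEquiv := by
  classical
  obtain ⟨A, hA, hAae, hAY, h1, h2⟩ := exists_invariant_conull τ hτ hY hYae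
  have he : MeasurableEmbedding ((↑) : A → X) := MeasurableEmbedding.subtype_coe hA
  let μ' : Measure A := μ.comap (↑)
  have hmap : μ'.map (↑) = μ := by
    rw [map_comap_subtype_coe hA]
    exact Measure.restrict_eq_self_of_ae_mem hAae
  have hprob : IsProbabilityMeasure μ' := ⟨by
    have h3 : μ'.map ((↑) : A → X) Set.univ = 1 := by rw [hmap]; simp
    rwa [he.map_apply, Set.preimage_univ] at h3⟩
  let ι : A × Fin d → X × Fin d := Prod.map (↑) id
  have hι : MeasurableEmbedding ι := he.prodMap MeasurableEmbedding.id
  have hιmap : (μ'.prod Measure.count).map ι = μ.prod Measure.count := by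
    rw [← hmap, ← Measure.map_prod_map _ _ he.measurable measurable_id, Measure.map_id]
  let τ' := edgePermRestrict τ A h1 h2
  have hcomm : ∀ y, ι (τ' y) = τ (ι y) := fun y => rfl
  have hcomm' : ∀ y, ι (τ'.symm y) = τ.symm (ι y) := fun y => rfl
  refine ⟨A, inferInstance, hA.standardBorel, μ', hprob, τ', ?_, ?_, ?_⟩
  · refine ⟨τ'.measurable, ?_⟩
    ext S hS
    have h3 : ∀ T : Set (A × Fin d), (μ'.prod Measure.count) T =
        (μ.prod Measure.count) (ι '' T) := fun T => by
      rw [← hιmap, hι.map_apply, hι.injective.preimage_image]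
    rw [Measure.map_apply τ'.measurable hS, h3, h3,
      ← hτ.measure_preimage (hι.measurableSet_image.2 hS).nullMeasurableSet]
    congr 1
    ext y
    constructor
    · rintro ⟨z, hz, rfl⟩
      exact ⟨τ' z, hz, rfl⟩
    · rintro ⟨z, hz, hzy⟩
      refine ⟨τ'.symm z, by simpa using hz, ?_⟩
      rw [hcomm', hzy, τ.symm_apply_apply]
  · intro F y₀
    obtain ⟨ψ, h3, h4⟩ := hsep (F.image ι) (by
      intro y hy
      obtain ⟨z, -, rfl⟩ := Finset.mem_image.1 hy
      exact hAY _ z.1.2 _) (ι y₀) (hAY _ y₀.1.2 _)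
    exact ⟨fun x => ψ x, h3, fun y hy hne =>
      h4 (ι y) (Finset.mem_image_of_mem _ hy) fun h => hne (hι.injective h)⟩
  · intro g hg hcons
    let G : X × Fin d → ℝ := Function.extend ι g 0
    have hG : ∀ y, G (ι y) = g y := fun y => hι.injective.extend_apply _ _ _
    have hG' : G ∘ ι = g := funext hG
    obtain ⟨c, hc⟩ := hu G (by rwa [← hιmap, hι.memLp_map_measure_iff, hG']) (by
      rw [← hmap, he.ae_map_iff]
      filter_upwards [hcons] with x hx
      have h3 : ∀ i, G (x, i) = g (x, i) := fun i => hG (x, i)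
      have h4 : ∀ i, G (τ.symm (x, i)) = g (τ'.symm (x, i)) := fun i => hG (τ'.symm (x, i))
      simp_rw [h3]
      exact hx.trans (Finset.sum_congr rfl fun i _ => (h4 i).symm))
    refine ⟨c, ?_⟩
    rw [Filter.EventuallyEq, ← hιmap, hι.ae_map_iff] at hc
    filter_upwards [hc] with y hy
    rw [← hG, hy]

end Restriction

/-! ### Gluing involutions with overlapping supports -/

section GluedInvolution

variable {α : Type*} (κ : ℕ → α → α) (A : ℕ → Set α)

/-- The points of `A n` such that neither they nor their images under `κ n` lie in any later `A m`. -/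
def lastActive (n : ℕ) : Set α := {z | z ∈ A n ∧ ∀ m > n, z ∉ A m ∧ κ n z ∉ A m}

open Classical in
/-- The map that acts as `κ n` on `lastActive κ A n`, for all `n`, and as the identity elsewhere. -/
noncomputable def gluedMap (z : α) : α :=
  if h : ∃ n, z ∈ lastActive κ A n then κ h.choose z else z

variable {κ A}

theorem lastActive_unique {z : α} {m n : ℕ} (hm : z ∈ lastActive κ A m)
    (hn : z ∈ lastActive κ A n) : m = n := by
  rcases lt_trichotomy m n with h | h | h
  · exact ((hm.2 n h).1 hn.1).elim
  · exact h
  · exact ((hn.2 m h).1 hm.1).elim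

theorem gluedMap_of_mem {z : α} {n : ℕ} (hz : z ∈ lastActive κ A n) : gluedMap κ A z = κ n z := by
  have h : ∃ n, z ∈ lastActive κ A n := ⟨n, hz⟩
  rw [gluedMap, dif_pos h, lastActive_unique h.choose_spec hz]

theorem gluedMap_of_forall_notMem {z : α} (hz : ∀ n, z ∉ lastActive κ A n) :
    gluedMap κ A z = z :=
  dif_neg (not_exists.2 hz)

/-- The condition defining `lastActive` is symmetric in `z` and `κ n z`. This is why it mentions
both points, and why the glued map is an involution. -/
theorem map_mem_lastActive (hκ : ∀ n, Function.Involutive (κ n))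
    (hA : ∀ n, ∀ z ∈ A n, κ n z ∈ A n) {z : α} {n : ℕ} (hz : z ∈ lastActive κ A n) :
    κ n z ∈ lastActive κ A n := by
  refine ⟨hA n z hz.1, fun m hm => ⟨(hz.2 m hm).2, ?_⟩⟩
  rw [hκ n z]
  exact (hz.2 m hm).1

theorem gluedMap_involutive (hκ : ∀ n, Function.Involutive (κ n))
    (hA : ∀ n, ∀ z ∈ A n, κ n z ∈ A n) : Function.Involutive (gluedMap κ A) := by
  intro z
  by_cases h : ∃ n, z ∈ lastActive κ A n
  · obtain ⟨n, hn⟩ := h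
    rw [gluedMap_of_mem hn, gluedMap_of_mem (map_mem_lastActive hκ hA hn), hκ n z]
  · rw [gluedMap_of_forall_notMem (not_exists.1 h), gluedMap_of_forall_notMem (not_exists.1 h)]

theorem gluedMap_preimage (S : Set α) : gluedMap κ A ⁻¹' S =
    (⋃ n, (lastActive κ A n ∩ κ n ⁻¹' S)) ∪ ((⋃ n, lastActive κ A n)ᶜ ∩ S) := by
  ext z
  by_cases h : ∃ n, z ∈ lastActive κ A n
  · obtain ⟨n, hn⟩ := h
    have hex : ∃ n, z ∈ lastActive κ A n := ⟨n, hn⟩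
    simp only [Set.mem_preimage, gluedMap_of_mem hn, Set.mem_union, Set.mem_iUnion,
      Set.mem_inter_iff, Set.mem_compl_iff, hex, not_true_eq_false, false_and, or_false]
    constructor
    · exact fun h => ⟨n, hn, h⟩
    · rintro ⟨m, hm, h⟩
      rwa [lastActive_unique hn hm]
  · simp only [Set.mem_preimage, gluedMap_of_forall_notMem (not_exists.1 h), Set.mem_union,
      Set.mem_iUnion, Set.mem_inter_iff, Set.mem_compl_iff, h, not_false_eq_true, true_and]
    push Not at h
    simp [h]

variable [MeasurableSpace α]

theorem measurableSet_lastActive (hκm : ∀ n, Measurable (κ n)) (hAm : ∀ n, MeasurableSet (A n))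
    (n : ℕ) : MeasurableSet (lastActive κ A n) := by
  have : lastActive κ A n = A n ∩ ⋂ m, ⋂ (_ : m > n), ((A m)ᶜ ∩ κ n ⁻¹' (A m)ᶜ) := by
    ext z
    simp [lastActive]
  rw [this]
  exact (hAm n).inter (MeasurableSet.iInter fun m => MeasurableSet.iInter fun _ =>
    (hAm m).compl.inter (hκm n (hAm m).compl))

/-- The sets `lastActive κ A n` are disjoint, and each is invariant under its own measure preserving
involution. -/
theorem measurePreserving_gluedMap {ν : Measure α} (hκ : ∀ n, Function.Involutive (κ n))
    (hA : ∀ n, ∀ z ∈ A n, κ n z ∈ A n) (hκν : ∀ n, MeasurePreserving (κ n) ν ν)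
    (hAm : ∀ n, MeasurableSet (A n)) : MeasurePreserving (gluedMap κ A) ν ν := by
  have hB := measurableSet_lastActive (fun n => (hκν n).measurable) hAm
  have hdisj : Pairwise (Function.onFun Disjoint (lastActive κ A)) := fun m n hmn =>
    Set.disjoint_left.2 fun z hm hn => hmn (lastActive_unique hm hn)
  have hmeas : Measurable (gluedMap κ A) := fun S hS => by
    rw [gluedMap_preimage]
    exact (MeasurableSet.iUnion fun n => (hB n).inter ((hκν n).measurable hS)).union
      ((MeasurableSet.iUnion hB).compl.inter hS)
  refine ⟨hmeas, ?_⟩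
  ext S hS
  have hpre : ∀ n, lastActive κ A n ∩ κ n ⁻¹' S = κ n ⁻¹' (lastActive κ A n ∩ S) := by
    intro n
    ext z
    refine and_congr_left fun _ => ⟨map_mem_lastActive hκ hA, fun h => ?_⟩
    rw [← hκ n z]
    exact map_mem_lastActive hκ hA h
  rw [Measure.map_apply hmeas hS, gluedMap_preimage, measure_union ?_
    ((MeasurableSet.iUnion hB).compl.inter hS), measure_iUnion ?_
    fun n => (hB n).inter ((hκν n).measurable hS)]
  · simp_rw [hpre]
    rw [tsum_congr fun n => (hκν n).measure_preimage ((hB n).inter hS).nullMeasurableSet,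
      ← measure_iUnion (fun m n hmn => (hdisj hmn).mono Set.inter_subset_left Set.inter_subset_left)
        (fun n => (hB n).inter hS), ← Set.iUnion_inter, Set.inter_comm, Set.inter_comm _ S,
      ← Set.sdiff_eq]
    exact measure_inter_add_sdiff S (MeasurableSet.iUnion hB)
  · exact fun m n hmn => (hdisj hmn).mono Set.inter_subset_left Set.inter_subset_left
  · refine Set.disjoint_left.2 fun z h1 h2 => h2.1 ?_
    obtain ⟨n, hn⟩ := Set.mem_iUnion.1 h1
    exact Set.mem_iUnion.2 ⟨n, hn.1⟩

end GluedInvolution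

/-! ### Triangular shifts and block swaps of sequences -/

section SequenceSpace

/-- Sequences whose `n`-th term is a residue modulo `M n + 1`. -/
abbrev BoundedSeq (M : ℕ → ℕ) : Type := ∀ n, Fin (M n + 1)

variable {M : ℕ → ℕ} {d : ℕ}

/-- Two labelled sequences agree up to level `m` if they have the same label and the same first `m`
terms. -/
def AgreeUpTo (m : ℕ) (y y' : BoundedSeq M × Fin d) : Prop :=
  y.2 = y'.2 ∧ ∀ k < m, y.1 k = y'.1 k

namespace AgreeUpTo

variable {m n : ℕ} {y y' y'' : BoundedSeq M × Fin d}

theorem refl (m : ℕ) (y : BoundedSeq M × Fin d) : AgreeUpTo m y y := ⟨rfl, fun _ _ => rfl⟩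

theorem symm (h : AgreeUpTo m y y') : AgreeUpTo m y' y := ⟨h.1.symm, fun k hk => (h.2 k hk).symm⟩

theorem trans (h : AgreeUpTo m y y') (h' : AgreeUpTo m y' y'') : AgreeUpTo m y y'' :=
  ⟨h.1.trans h'.1, fun k hk => (h.2 k hk).trans (h'.2 k hk)⟩

theorem mono (h : AgreeUpTo n y y') (hmn : m ≤ n) : AgreeUpTo m y y' :=
  ⟨h.1, fun k hk => h.2 k (hk.trans_le hmn)⟩

theorem congr_left (h : AgreeUpTo m y y') : AgreeUpTo m y y'' ↔ AgreeUpTo m y' y'' :=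
  ⟨h.symm.trans, h.trans⟩

theorem eq_of_forall (h : ∀ m, AgreeUpTo m y y') : y = y' :=
  Prod.ext (funext fun k => (h (k + 1)).2 k k.lt_succ_self) (h 0).1

end AgreeUpTo

section Shift

variable (P Q : ℕ → BoundedSeq M × Fin d) (ℓ : ℕ → ℕ)

open Classical in
/-- `1` near `P n`, `-1` near `Q n`, `0` elsewhere. -/
noncomputable def levelShift (n : ℕ) (y : BoundedSeq M × Fin d) : Fin (M n + 1) :=
  (if AgreeUpTo (ℓ n) y (P n) then 1 else 0) - if AgreeUpTo (ℓ n) y (Q n) then 1 else 0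

/-- Add the level shifts to all terms. -/
noncomputable def shiftMap (y : BoundedSeq M × Fin d) : BoundedSeq M × Fin d :=
  (fun n => y.1 n + levelShift P Q ℓ n y, y.2)

variable {P Q ℓ}

theorem levelShift_congr {m n : ℕ} {y y' : BoundedSeq M × Fin d} (h : AgreeUpTo m y y')
    (hn : ℓ n ≤ m) : levelShift P Q ℓ n y = levelShift P Q ℓ n y' := by
  have h1 : ∀ r, AgreeUpTo (ℓ n) y r ↔ AgreeUpTo (ℓ n) y' r := fun r => (h.mono hn).congr_left
  classical
  exact congrArg₂ (· - ·) (if_congr (h1 _) rfl rfl) (if_congr (h1 _) rfl rfl)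

/-- The shift of term `n` depends only on the label and on terms before `n`, so the terms can be
recovered one after another. -/
theorem agreeUpTo_shiftMap_iff (hℓ : ∀ n, ℓ n ≤ n) {m : ℕ} {y y' : BoundedSeq M × Fin d} :
    AgreeUpTo m (shiftMap P Q ℓ y) (shiftMap P Q ℓ y') ↔ AgreeUpTo m y y' := by
  constructor
  · intro h
    induction m with
    | zero => exact ⟨h.1, fun k hk => absurd hk k.not_lt_zero⟩
    | succ m ih =>
      have h1 := ih (h.mono m.le_succ)
      refine ⟨h.1, fun k hk => ?_⟩
      rcases Nat.lt_succ_iff_lt_or_eq.1 hk with hk | rfl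
      · exact h1.2 k hk
      · have h2 := h.2 k hk
        simp only [shiftMap, levelShift_congr h1 (hℓ k)] at h2
        exact add_right_cancel h2
  · intro h
    refine ⟨h.1, fun k hk => ?_⟩
    simp only [shiftMap, levelShift_congr (h.mono hk.le) (hℓ k), h.2 k hk]

theorem shiftMap_injective (hℓ : ∀ n, ℓ n ≤ n) : Function.Injective (shiftMap P Q ℓ) := by
  intro y y' h
  refine AgreeUpTo.eq_of_forall fun m => (agreeUpTo_shiftMap_iff (P := P) (Q := Q) hℓ).1 ?_
  rw [h]
  exact AgreeUpTo.refl _ _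

theorem shiftMap_surjective (hℓ : ∀ n, ℓ n ≤ n) : Function.Surjective (shiftMap P Q ℓ) := by
  intro z
  -- A preimage of `z` is a fixed point of `B`. As `B` improves agreement by one term, its iterates
  -- stabilise term by term.
  let B : BoundedSeq M × Fin d → BoundedSeq M × Fin d := fun y =>
    (fun n => z.1 n - levelShift P Q ℓ n y, z.2)
  have hB : ∀ {m y y'}, AgreeUpTo m y y' → AgreeUpTo (m + 1) (B y) (B y') := by
    intro m y y' h
    refine ⟨rfl, fun k hk => ?_⟩
    simp only [B, levelShift_congr h ((hℓ k).trans (Nat.lt_succ_iff.1 hk))]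
  have hiter : ∀ k j, AgreeUpTo k (B^[k] z) (B^[k + j] z) := by
    intro k
    induction k with
    | zero =>
      intro j
      refine ⟨?_, fun k hk => absurd hk k.not_lt_zero⟩
      cases j with
      | zero => rfl
      | succ j => rw [← add_assoc, Function.iterate_succ_apply']; rfl
    | succ k ih =>
      intro j
      rw [Nat.succ_add, Function.iterate_succ_apply', Function.iterate_succ_apply']
      exact hB (ih j)
  let y : BoundedSeq M × Fin d := (fun n => (B^[n + 1] z).1 n, z.2)
  have hlim : ∀ k, AgreeUpTo k (B^[k] z) y := by
    intro k
    refine ⟨by simpa using (hiter 0 k).1.symm, fun n hn => ?_⟩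
    obtain ⟨j, rfl⟩ := Nat.exists_eq_add_of_lt hn
    have := (hiter (n + 1) j).2 n n.lt_succ_self
    rw [show n + j + 1 = n + 1 + j by ring]
    exact this.symm
  have hfix : ∀ n, (B y).1 n = y.1 n := fun n => by
    have h1 := (hB (hlim n)).2 n n.lt_succ_self
    rw [← h1, ← Function.iterate_succ_apply' B]
  refine ⟨y, Prod.ext (funext fun n => ?_) rfl⟩
  change y.1 n + levelShift P Q ℓ n y = z.1 n
  rw [← hfix n]
  exact sub_add_cancel _ _

/-- `shiftMap` as a permutation. -/
noncomputable def shiftEquiv (P Q : ℕ → BoundedSeq M × Fin d) {ℓ : ℕ → ℕ} (hℓ : ∀ n, ℓ n ≤ n) :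
    Equiv.Perm (BoundedSeq M × Fin d) :=
  Equiv.ofBijective _ ⟨shiftMap_injective (P := P) (Q := Q) hℓ, shiftMap_surjective hℓ⟩

end Shift

section Swap

/-- Overwrite the label and the first `l` terms by those of `q`, and the `n`-th term by `b`. -/
def overwrite (l n : ℕ) (q : BoundedSeq M × Fin d) (b : Fin (M n + 1))
    (z : BoundedSeq M × Fin d) : BoundedSeq M × Fin d :=
  (fun k => if k < l then q.1 k else Function.update z.1 n b k, q.2)

open Classical in
/-- Exchange the sequences that agree with `p` up to level `l` and have `n`-th term `a` with those
that agree with `q` up to level `l` and have `n`-th term `b`. -/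
noncomputable def blockSwap (l n : ℕ) (p q : BoundedSeq M × Fin d) (a b : Fin (M n + 1))
    (z : BoundedSeq M × Fin d) : BoundedSeq M × Fin d :=
  if AgreeUpTo l z p ∧ z.1 n = a then overwrite l n q b z
  else if AgreeUpTo l z q ∧ z.1 n = b then overwrite l n p a z else z

/-- The points moved by `blockSwap`. -/
def blockSwapSupport (l n : ℕ) (p q : BoundedSeq M × Fin d) (a b : Fin (M n + 1)) :
    Set (BoundedSeq M × Fin d) :=
  {z | (AgreeUpTo l z p ∧ z.1 n = a) ∨ (AgreeUpTo l z q ∧ z.1 n = b)}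

variable {l n : ℕ} {p q z : BoundedSeq M × Fin d} {a b : Fin (M n + 1)}

theorem agreeUpTo_overwrite : AgreeUpTo l (overwrite l n q b z) q :=
  ⟨rfl, fun k hk => by simp [overwrite, hk]⟩

theorem overwrite_apply (hl : l ≤ n) : (overwrite l n q b z).1 n = b := by
  simp [overwrite, hl.not_gt]

theorem overwrite_apply_of_lt (hl : l ≤ n) {k : ℕ} (hk : n < k) :
    (overwrite l n q b z).1 k = z.1 k := by
  simp [overwrite, (hl.trans_lt hk).not_gt, hk.ne']

theorem overwrite_overwrite (hp : AgreeUpTo l z p) (ha : z.1 n = a) :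
    overwrite l n p a (overwrite l n q b z) = z := by
  refine Prod.ext (funext fun k => ?_) hp.1.symm
  simp only [overwrite]
  split_ifs with hk
  · exact (hp.2 k hk).symm
  · by_cases hkn : k = n
    · subst hkn
      simp [ha]
    · simp [hkn, hk]

theorem blockSwap_left (hp : AgreeUpTo l z p) (ha : z.1 n = a) :
    blockSwap l n p q a b z = overwrite l n q b z := if_pos ⟨hp, ha⟩

theorem blockSwap_right (hab : a ≠ b) (hq : AgreeUpTo l z q) (hb : z.1 n = b) :
    blockSwap l n p q a b z = overwrite l n p a z := by
  rw [blockSwap, if_neg fun h => hab (h.2.symm.trans hb), if_pos ⟨hq, hb⟩]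

theorem blockSwap_of_notMem (hz : z ∉ blockSwapSupport l n p q a b) :
    blockSwap l n p q a b z = z := by
  rw [blockSwap, if_neg fun h => hz (Or.inl h), if_neg fun h => hz (Or.inr h)]

theorem blockSwap_mem_support (hl : l ≤ n) (hab : a ≠ b)
    (hz : z ∈ blockSwapSupport l n p q a b) :
    blockSwap l n p q a b z ∈ blockSwapSupport l n p q a b := by
  rcases hz with ⟨h1, h2⟩ | ⟨h1, h2⟩
  · rw [blockSwap_left h1 h2]
    exact Or.inr ⟨agreeUpTo_overwrite, overwrite_apply hl⟩
  · rw [blockSwap_right hab h1 h2]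
    exact Or.inl ⟨agreeUpTo_overwrite, overwrite_apply hl⟩

theorem blockSwap_involutive (hl : l ≤ n) (hab : a ≠ b) :
    Function.Involutive (blockSwap l n p q a b) := by
  intro z
  by_cases hz : z ∈ blockSwapSupport l n p q a b
  · rcases hz with ⟨h1, h2⟩ | ⟨h1, h2⟩
    · rw [blockSwap_left h1 h2, blockSwap_right hab agreeUpTo_overwrite (overwrite_apply hl),
        overwrite_overwrite h1 h2]
    · rw [blockSwap_right hab h1 h2, blockSwap_left agreeUpTo_overwrite (overwrite_apply hl),
        overwrite_overwrite h1 h2]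
  · rw [blockSwap_of_notMem hz, blockSwap_of_notMem hz]

theorem blockSwap_apply_of_lt (hl : l ≤ n) {k : ℕ} (hk : n < k) :
    (blockSwap l n p q a b z).1 k = z.1 k := by
  rw [blockSwap]
  split_ifs
  · exact overwrite_apply_of_lt hl hk
  · exact overwrite_apply_of_lt hl hk
  · rfl

theorem AgreeUpTo.overwrite {m : ℕ} {z' : BoundedSeq M × Fin d} (h : AgreeUpTo m z z') :
    AgreeUpTo m (overwrite l n q b z) (_root_.overwrite l n q b z') := by
  refine ⟨rfl, fun k hk => ?_⟩
  simp only [_root_.overwrite]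
  split_ifs
  · rfl
  · by_cases hkn : k = n
    · subst hkn
      simp
    · simp [hkn, h.2 k hk]

theorem AgreeUpTo.blockSwap (hl : l ≤ n) {m : ℕ} (hm : n < m) {z' : BoundedSeq M × Fin d}
    (h : AgreeUpTo m z z') :
    AgreeUpTo m (blockSwap l n p q a b z) (_root_.blockSwap l n p q a b z') := by
  have h1 : ∀ r, AgreeUpTo l z r ↔ AgreeUpTo l z' r := fun r =>
    (h.mono (hl.trans hm.le)).congr_left
  by_cases hp : AgreeUpTo l z p ∧ z.1 n = a
  · rw [_root_.blockSwap, _root_.blockSwap, if_pos hp, if_pos (by rwa [← h1, ← h.2 n hm])]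
    exact h.overwrite
  by_cases hq : AgreeUpTo l z q ∧ z.1 n = b
  · rw [_root_.blockSwap, _root_.blockSwap, if_neg hp, if_pos hq,
      if_neg (by rwa [← h1, ← h.2 n hm]), if_pos (by rwa [← h1, ← h.2 n hm])]
    exact h.overwrite
  · rw [_root_.blockSwap, _root_.blockSwap, if_neg hp, if_neg hq,
      if_neg (by rwa [← h1, ← h.2 n hm]), if_neg (by rwa [← h1, ← h.2 n hm])]
    exact h

/-- The prefix must reach beyond `n`, since term `n` decides whether a sequence is moved. -/
theorem agreeUpTo_blockSwap_iff (hl : l ≤ n) (hab : a ≠ b) {m : ℕ} (hm : n < m)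
    {z' : BoundedSeq M × Fin d} :
    AgreeUpTo m (blockSwap l n p q a b z) (blockSwap l n p q a b z') ↔ AgreeUpTo m z z' := by
  refine ⟨fun h => ?_, fun h => h.blockSwap hl hm⟩
  have := h.blockSwap (p := p) (q := q) (a := a) (b := b) hl hm
  rwa [blockSwap_involutive hl hab, blockSwap_involutive hl hab] at this

end Swap

end SequenceSpace

/-! ### The uniform measure and its cylinders -/

section SequenceMeasure

variable {M : ℕ → ℕ} {d : ℕ}

/-- The uniform measure on bounded sequences. -/
noncomputable def seqMeasure (M : ℕ → ℕ) : Measure (BoundedSeq M) :=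
  Measure.infinitePi fun n => (PMF.uniformOfFintype (Fin (M n + 1))).toMeasure

instance : IsProbabilityMeasure (seqMeasure M) := by
  unfold seqMeasure
  infer_instance

/-- The uniform measure on labelled bounded sequences, of total mass `d`. -/
noncomputable abbrev labelledMeasure (M : ℕ → ℕ) (d : ℕ) : Measure (BoundedSeq M × Fin d) :=
  (seqMeasure M).prod Measure.count

/-- The labelled sequences that agree with `q` up to level `m`. -/
def agreeCylinder (m : ℕ) (q : BoundedSeq M × Fin d) : Set (BoundedSeq M × Fin d) :=
  {y | AgreeUpTo m y q}

theorem agreeCylinder_eq_prod (m : ℕ) (q : BoundedSeq M × Fin d) : agreeCylinder m q =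
    ((Finset.range m : Set ℕ).pi fun k => {q.1 k}) ×ˢ {q.2} := by
  ext y
  simp [agreeCylinder, AgreeUpTo, Set.mem_pi, and_comm]

theorem measurableSet_agreeCylinder (m : ℕ) (q : BoundedSeq M × Fin d) :
    MeasurableSet (agreeCylinder m q) := by
  rw [agreeCylinder_eq_prod]
  exact (MeasurableSet.pi (Finset.range m).countable_toSet fun k _ =>
    measurableSet_singleton _).prod (measurableSet_singleton _)

theorem labelledMeasure_agreeCylinder (m : ℕ) (q : BoundedSeq M × Fin d) :
    labelledMeasure M d (agreeCylinder m q) =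
      ∏ k ∈ Finset.range m, ((M k + 1 : ℕ) : ℝ≥0∞)⁻¹ := by
  rw [agreeCylinder_eq_prod, Measure.prod_prod, seqMeasure, Measure.infinitePi_pi _ fun k _ =>
    measurableSet_singleton _]
  simp

theorem agreeCylinder_congr {m : ℕ} {q q' : BoundedSeq M × Fin d} (h : AgreeUpTo m q q') :
    agreeCylinder m q = agreeCylinder m q' :=
  Set.ext fun _ => ⟨fun h' => AgreeUpTo.trans h' h, fun h' => AgreeUpTo.trans h' h.symm⟩

/-- Representatives of the cylinders of level `m`. -/
def extendWord (m : ℕ) (b : (∀ k : Fin m, Fin (M k + 1)) × Fin d) : BoundedSeq M × Fin d :=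
  (fun k => if h : k < m then b.1 ⟨k, h⟩ else 0, b.2)

/-- The labelled word of length `m` of a labelled sequence. -/
def truncateWord (m : ℕ) (y : BoundedSeq M × Fin d) : (∀ k : Fin m, Fin (M k + 1)) × Fin d :=
  (fun k => y.1 k, y.2)

theorem agreeUpTo_extendWord_iff {m : ℕ} {y : BoundedSeq M × Fin d}
    {b : (∀ k : Fin m, Fin (M k + 1)) × Fin d} :
    AgreeUpTo m y (extendWord m b) ↔ truncateWord m y = b := by
  constructor
  · rintro ⟨h1, h2⟩
    refine Prod.ext (funext fun k => ?_) h1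
    have := h2 k k.2
    simpa [extendWord, truncateWord] using this
  · rintro rfl
    exact ⟨rfl, fun k hk => by simp [extendWord, truncateWord, hk]⟩

theorem measurableSet_generateFrom_of_saturated {m₀ m : ℕ} (hm : m₀ ≤ m)
    {S : Set (BoundedSeq M × Fin d)} (hS : ∀ y y', AgreeUpTo m y y' → y ∈ S → y' ∈ S) :
    MeasurableSet[MeasurableSpace.generateFrom {s | ∃ k ≥ m₀, ∃ q, s = agreeCylinder k q}] S := by
  have : S = ⋃ b ∈ {b | extendWord m b ∈ S}, agreeCylinder m (extendWord m b) := by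
    ext y
    simp only [Set.mem_iUnion, exists_prop, Set.mem_ofPred_eq]
    have h := agreeUpTo_extendWord_iff.2 (rfl : truncateWord m y = _)
    exact ⟨fun hy => ⟨truncateWord m y, hS _ _ h hy, h⟩,
      fun ⟨b, hb, hyb⟩ => hS _ _ (AgreeUpTo.symm hyb) hb⟩
  rw [this]
  exact MeasurableSet.biUnion (Set.to_countable _) fun b _ =>
    MeasurableSpace.measurableSet_generateFrom ⟨m, hm, _, rfl⟩

theorem generateFrom_agreeCylinder (m₀ : ℕ) :
    (inferInstance : MeasurableSpace (BoundedSeq M × Fin d)) =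
      MeasurableSpace.generateFrom {s | ∃ k ≥ m₀, ∃ q, s = agreeCylinder k q} := by
  apply le_antisymm
  · refine sup_le ?_ ?_
    · rw [← measurable_iff_comap_le]
      refine @measurable_pi_lambda _ _ _ (_) _ _ fun n => ?_
      refine @measurable_to_countable' _ _ _ _ (_) _ fun a => ?_
      refine measurableSet_generateFrom_of_saturated (le_max_left m₀ (n + 1)) ?_
      intro y y' h hy
      exact (h.2 n (lt_of_lt_of_le n.lt_succ_self (le_max_right _ _))).symm.trans hy
    · rw [← measurable_iff_comap_le]
      refine @measurable_to_countable' _ _ _ _ (_) _ fun a => ?_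
      exact measurableSet_generateFrom_of_saturated le_rfl fun y y' h hy => h.1.symm.trans hy
  · refine MeasurableSpace.generateFrom_le ?_
    rintro _ ⟨k, -, q, rfl⟩
    exact measurableSet_agreeCylinder k q

/-- Two cylinders are nested or disjoint. -/
theorem isPiSystem_agreeCylinder (m₀ : ℕ) :
    IsPiSystem {s : Set (BoundedSeq M × Fin d) | ∃ k ≥ m₀, ∃ q, s = agreeCylinder k q} := by
  have key : ∀ {k l : ℕ} {q r y : BoundedSeq M × Fin d}, k ≤ l → AgreeUpTo k y q →
      AgreeUpTo l y r → agreeCylinder k q ∩ agreeCylinder l r = agreeCylinder l r := by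
    intro k l q r y hkl hq hr
    refine Set.inter_eq_right.2 fun z hz => ?_
    exact ((AgreeUpTo.trans hz hr.symm).mono hkl).trans hq
  rintro _ ⟨k, hk, q, rfl⟩ _ ⟨l, hl, r, rfl⟩ ⟨y, hq, hr⟩
  rcases le_total k l with h | h
  · exact ⟨l, hl, r, key h hq hr⟩
  · exact ⟨k, hk, q, by rw [Set.inter_comm]; exact key h hr hq⟩

/-- Such a map permutes the cylinders of each level from `m₀` on; those of one level have equal
measure, and together they generate. The threshold `m₀` admits swaps, which respect only deep
levels. -/
theorem measurePreserving_of_agreeUpTo_iff (m₀ : ℕ) (T : Equiv.Perm (BoundedSeq M × Fin d))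
    (hT : ∀ m ≥ m₀, ∀ y y', AgreeUpTo m (T y) (T y') ↔ AgreeUpTo m y y') :
    MeasurePreserving T (labelledMeasure M d) (labelledMeasure M d) := by
  have hpre : ∀ m ≥ m₀, ∀ q, T ⁻¹' agreeCylinder m q = agreeCylinder m (T.symm q) := by
    intro m hm q
    ext y
    have := hT m hm y (T.symm q)
    rwa [T.apply_symm_apply] at this
  have hmeas : Measurable T := by
    have h1 : @Measurable _ _ _ (MeasurableSpace.generateFrom
        {s : Set (BoundedSeq M × Fin d) | ∃ k ≥ m₀, ∃ q, s = agreeCylinder k q}) T := by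
      refine measurable_generateFrom ?_
      rintro _ ⟨k, hk, q, rfl⟩
      rw [hpre k hk]
      exact measurableSet_agreeCylinder _ _
    exact h1.mono le_rfl (generateFrom_agreeCylinder m₀).le
  refine ⟨hmeas, ?_⟩
  have : IsFiniteMeasure ((labelledMeasure M d).map T) := by infer_instance
  refine ext_of_generate_finite _ (generateFrom_agreeCylinder m₀) (isPiSystem_agreeCylinder m₀) ?_ ?_
  · rintro _ ⟨k, hk, q, rfl⟩
    rw [Measure.map_apply hmeas (measurableSet_agreeCylinder _ _), hpre k hk,
      labelledMeasure_agreeCylinder, labelledMeasure_agreeCylinder]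
  · rw [Measure.map_apply hmeas MeasurableSet.univ, Set.preimage_univ]

theorem setIntegral_agreeCylinder_sum (m : ℕ) {f : BoundedSeq M × Fin d → ℝ}
    (hf : Integrable f (labelledMeasure M d)) :
    ∫ y, f y ∂labelledMeasure M d =
      ∑ b, ∫ y in agreeCylinder m (extendWord m b), f y ∂labelledMeasure M d := by
  rw [← integral_iUnion_fintype (fun b => measurableSet_agreeCylinder _ _) ?_
    fun b => hf.integrableOn]
  · have : ⋃ b, agreeCylinder m (extendWord m b) =
        (Set.univ : Set (BoundedSeq M × Fin d)) := by
      refine Set.eq_univ_of_forall fun y => Set.mem_iUnion.2 ⟨truncateWord m y, ?_⟩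
      exact agreeUpTo_extendWord_iff.2 rfl
    rw [this, setIntegral_univ]
  · intro b b' hne
    refine Set.disjoint_left.2 fun y hy hy' => hne ?_
    exact (agreeUpTo_extendWord_iff.1 hy).symm.trans (agreeUpTo_extendWord_iff.1 hy')

/-- An integrable function whose integrals over cylinders depend on the level only is constant. -/
theorem ae_const_of_setIntegral_agreeCylinder [NeZero d] {f : BoundedSeq M × Fin d → ℝ}
    (hf : Integrable f (labelledMeasure M d))
    (h : ∀ m q q', ∫ y in agreeCylinder m q, f y ∂labelledMeasure M d =
      ∫ y in agreeCylinder m q', f y ∂labelledMeasure M d) :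
    ∃ c : ℝ, f =ᵐ[labelledMeasure M d] fun _ => c := by
  set ν := labelledMeasure M d
  set c : ℝ := (∫ y, f y ∂ν) / d
  have hd : (d : ℝ) ≠ 0 := by exact_mod_cast NeZero.ne d
  have hνuniv : ν Set.univ = d := by
    simp [ν, labelledMeasure, ← Set.univ_prod_univ, Measure.prod_prod]
  have hg : Integrable (fun y => f y - c) ν := hf.sub (integrable_const c)
  have hgint : ∫ y, (f y - c) ∂ν = 0 := by
    rw [integral_sub hf (integrable_const c), integral_const, measureReal_def, hνuniv]
    simp [c]
    field_simp
    simp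
  -- The cylinders of level `m` partition the space; their integrals are equal and add up to zero.
  have hcyl : ∀ m q, ∫ y in agreeCylinder m q, (f y - c) ∂ν = 0 := by
    intro m q
    have h1 : ∀ b, ∫ y in agreeCylinder m (extendWord m b), (f y - c) ∂ν =
        ∫ y in agreeCylinder m q, (f y - c) ∂ν := by
      intro b
      rw [integral_sub hf.integrableOn (integrable_const c),
        integral_sub hf.integrableOn (integrable_const c), h m _ q, setIntegral_const,
        setIntegral_const, measureReal_def, measureReal_def, labelledMeasure_agreeCylinder,
        labelledMeasure_agreeCylinder]
    rw [setIntegral_agreeCylinder_sum m hg, Finset.sum_congr rfl fun b _ => h1 b,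
      Finset.sum_const, nsmul_eq_mul, mul_eq_zero] at hgint
    refine hgint.resolve_left ?_
    have : Nonempty ((∀ k : Fin m, Fin (M k + 1)) × Fin d) := ⟨(fun _ => 0, 0)⟩
    exact_mod_cast Finset.card_ne_zero.2 Finset.univ_nonempty
  have hall : ∀ s, MeasurableSet s → ∫ y in s, (f y - c) ∂ν = 0 := by
    intro s hs
    induction s, hs using MeasurableSpace.induction_on_inter (generateFrom_agreeCylinder 0)
      (isPiSystem_agreeCylinder 0) with
    | empty => simp
    | basic t ht =>
      obtain ⟨k, -, q, rfl⟩ := ht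
      exact hcyl k q
    | compl t htm ih => rw [setIntegral_compl htm hg, ih, hgint, sub_zero]
    | iUnion t hd htm ih =>
      rw [integral_iUnion htm hd hg.integrableOn]
      simp [ih]
  refine ⟨c, ?_⟩
  have h0 := hg.ae_eq_zero_of_forall_setIntegral_eq_zero fun s hs _ => hall s hs
  filter_upwards [h0] with y hy
  simp only [Pi.zero_apply] at hy
  linarith

end SequenceMeasure

/-! ### The edge permutation: turning coordinates, then swapping wrapped ends -/

section SwapConstruction

/-- For every coordinate `n`, two cylinders of level at most `n`. -/
structure CylinderPairs (M : ℕ → ℕ) (d : ℕ) where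
  /-- The centre of the first cylinder. -/
  P : ℕ → BoundedSeq M × Fin d
  /-- The centre of the second cylinder. -/
  Q : ℕ → BoundedSeq M × Fin d
  /-- The level of both cylinders. -/
  level : ℕ → ℕ
  level_le : ∀ n, level n ≤ n

namespace CylinderPairs

variable {M : ℕ → ℕ} {d : ℕ} (D : CylinderPairs M d)

/-- Turn the coordinate `n` forward over the first cylinder, backward over the second. -/
noncomputable def turn : Equiv.Perm (BoundedSeq M × Fin d) := shiftEquiv D.P D.Q D.level_le

/-- Exchange the bottom over the image of the first cylinder with the top over the image of the
second. -/
noncomputable def swap (n : ℕ) : BoundedSeq M × Fin d → BoundedSeq M × Fin d :=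
  blockSwap (D.level n) n (D.turn (D.P n)) (D.turn (D.Q n)) 0 (Fin.last (M n))

/-- The points moved by `swap`. -/
def swapSupport (n : ℕ) : Set (BoundedSeq M × Fin d) :=
  blockSwapSupport (D.level n) n (D.turn (D.P n)) (D.turn (D.Q n)) 0 (Fin.last (M n))

/-- All swaps, glued. -/
noncomputable def glue : BoundedSeq M × Fin d → BoundedSeq M × Fin d :=
  gluedMap D.swap D.swapSupport

variable {D}

theorem agreeUpTo_turn_iff {m : ℕ} {y y' : BoundedSeq M × Fin d} :
    AgreeUpTo m (D.turn y) (D.turn y') ↔ AgreeUpTo m y y' :=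
  agreeUpTo_shiftMap_iff D.level_le

theorem zero_ne_last (hM : ∀ n, 1 ≤ M n) (n : ℕ) : (0 : Fin (M n + 1)) ≠ Fin.last (M n) := by
  intro h
  have := congrArg Fin.val h
  simp only [Fin.val_zero, Fin.val_last] at this
  have := hM n
  omega

theorem swap_involutive (hM : ∀ n, 1 ≤ M n) (n : ℕ) : Function.Involutive (D.swap n) :=
  blockSwap_involutive (D.level_le n) (zero_ne_last hM n)

theorem swap_mem_swapSupport (hM : ∀ n, 1 ≤ M n) (n : ℕ) :
    ∀ z ∈ D.swapSupport n, D.swap n z ∈ D.swapSupport n := fun _ hz =>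
  blockSwap_mem_support (D.level_le n) (zero_ne_last hM n) hz

theorem measurableSet_coord (n : ℕ) (a : Fin (M n + 1)) :
    MeasurableSet {z : BoundedSeq M × Fin d | z.1 n = a} := by
  have h : Measurable fun z : BoundedSeq M × Fin d => z.1 n :=
    (measurable_pi_apply n).comp measurable_fst
  exact h (measurableSet_singleton a)

theorem measurableSet_swapSupport (n : ℕ) : MeasurableSet (D.swapSupport n) :=
  ((measurableSet_agreeCylinder _ _).inter (measurableSet_coord n _)).union
    ((measurableSet_agreeCylinder _ _).inter (measurableSet_coord n _))

theorem labelledMeasure_coord (n : ℕ) (a : Fin (M n + 1)) :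
    labelledMeasure M d {z | z.1 n = a} = ((M n + 1 : ℕ) : ℝ≥0∞)⁻¹ * d := by
  -- `HEq` is used because the type of `b` depends on `k`; only `k = n` matters.
  have : {z : BoundedSeq M × Fin d | z.1 n = a} =
      ((({n} : Finset ℕ) : Set ℕ).pi fun k => {b | HEq b a}) ×ˢ Set.univ := by
    ext z
    simp
  rw [this, Measure.prod_prod, seqMeasure, Measure.infinitePi_pi _ fun k _ =>
    MeasurableSet.of_discrete]
  simp

theorem labelledMeasure_swapSupport_le (n : ℕ) :
    labelledMeasure M d (D.swapSupport n) ≤ 2 * d * ((M n + 1 : ℕ) : ℝ≥0∞)⁻¹ := by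
  have hsub : D.swapSupport n ⊆ {z | z.1 n = 0} ∪ {z | z.1 n = Fin.last (M n)} := by
    rintro z (h | h)
    · exact Or.inl h.2
    · exact Or.inr h.2
  refine (measure_mono hsub).trans ((measure_union_le _ _).trans (le_of_eq ?_))
  rw [labelledMeasure_coord, labelledMeasure_coord]
  ring

theorem measurePreserving_swap (hM : ∀ n, 1 ≤ M n) (n : ℕ) :
    MeasurePreserving (D.swap n) (labelledMeasure M d) (labelledMeasure M d) :=
  measurePreserving_of_agreeUpTo_iff (n + 1) (swap_involutive hM n).toPerm fun _ hm _ _ =>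
    agreeUpTo_blockSwap_iff (D.level_le n) (zero_ne_last hM n) hm

theorem measurePreserving_glue (hM : ∀ n, 1 ≤ M n) :
    MeasurePreserving D.glue (labelledMeasure M d) (labelledMeasure M d) :=
  measurePreserving_gluedMap (swap_involutive hM) (swap_mem_swapSupport hM)
    (measurePreserving_swap hM) measurableSet_swapSupport

theorem glue_involutive (hM : ∀ n, 1 ≤ M n) : Function.Involutive D.glue :=
  gluedMap_involutive (swap_involutive hM) (swap_mem_swapSupport hM)

theorem measurePreserving_turn :
    MeasurePreserving D.turn (labelledMeasure M d) (labelledMeasure M d) :=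
  measurePreserving_of_agreeUpTo_iff 0 _ fun _ _ _ _ => agreeUpTo_turn_iff

theorem measurable_turn_symm : Measurable D.turn.symm :=
  (measurePreserving_of_agreeUpTo_iff 0 D.turn.symm fun m _ y y' => by
    rw [← agreeUpTo_turn_iff (D := D), D.turn.apply_symm_apply, D.turn.apply_symm_apply]).measurable

variable (D) in
/-- The edge permutation of the construction: turn all coordinates, then swap. -/
noncomputable def edgePerm (hM : ∀ n, 1 ≤ M n) :
    BoundedSeq M × Fin d ≃ᵐ BoundedSeq M × Fin d where
  toEquiv := D.turn.trans (glue_involutive (D := D) hM).toPerm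
  measurable_toFun := (measurePreserving_glue hM).measurable.comp measurePreserving_turn.measurable
  measurable_invFun := measurable_turn_symm.comp (measurePreserving_glue hM).measurable

theorem edgePerm_apply (hM : ∀ n, 1 ≤ M n) (y : BoundedSeq M × Fin d) :
    D.edgePerm hM y = D.glue (D.turn y) := rfl

theorem measurePreserving_edgePerm (hM : ∀ n, 1 ≤ M n) :
    MeasurePreserving (D.edgePerm hM) (labelledMeasure M d) (labelledMeasure M d) :=
  (measurePreserving_glue hM).comp measurePreserving_turn

theorem swap_apply_of_lt {m n : ℕ} (h : m < n) (z : BoundedSeq M × Fin d) :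
    (D.swap m z).1 n = z.1 n :=
  blockSwap_apply_of_lt (D.level_le m) h

/-- At most one swap acts on a point, and those with index below `n` leave coordinate `n` alone. -/
theorem glue_apply_of_notMem {n : ℕ} {z : BoundedSeq M × Fin d}
    (hz : ∀ m ≥ n, z ∉ D.swapSupport m) : (D.glue z).1 n = z.1 n := by
  by_cases h : ∃ m, z ∈ lastActive D.swap D.swapSupport m
  · obtain ⟨m, hm⟩ := h
    have hmn : m < n := by
      by_contra hcon
      exact hz m (not_lt.1 hcon) hm.1
    rw [glue, gluedMap_of_mem hm, swap_apply_of_lt hmn]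
  · rw [glue, gluedMap_of_forall_notMem (not_exists.1 h)]

open Classical in
variable (D) in
/-- The difference of the indicators of the two cylinders. -/
noncomputable def cylinderDiff (n : ℕ) (y : BoundedSeq M × Fin d) : ℝ :=
  (agreeCylinder (D.level n) (D.P n)).indicator 1 y -
    (agreeCylinder (D.level n) (D.Q n)).indicator 1 y

theorem abs_cylinderDiff_le (n : ℕ) (y : BoundedSeq M × Fin d) : |D.cylinderDiff n y| ≤ 1 := by
  classical
  simp only [cylinderDiff, Set.indicator_apply, Pi.one_apply]
  split_ifs <;> simp

variable (D) in
/-- The deviation of the change of the coordinate `n` along an edge from `cylinderDiff`. -/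
noncomputable def deviation (hM : ∀ n, 1 ≤ M n) (n : ℕ) (y : BoundedSeq M × Fin d) : ℝ :=
  ((D.edgePerm hM y).1 n : ℕ) - (y.1 n : ℕ) - D.cylinderDiff n y

theorem turn_apply (n : ℕ) (y : BoundedSeq M × Fin d) :
    (D.turn y).1 n = y.1 n + levelShift D.P D.Q D.level n y := rfl

theorem abs_deviation_le (hM : ∀ n, 1 ≤ M n) (n : ℕ) (y : BoundedSeq M × Fin d) :
    |D.deviation hM n y| ≤ (M n + 1 : ℕ) := by
  have h1 := abs_le.1 (D.abs_cylinderDiff_le n y)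
  have h2 : (((D.edgePerm hM y).1 n : ℕ) : ℝ) ≤ M n := by
    exact_mod_cast Nat.lt_succ_iff.1 ((D.edgePerm hM y).1 n).2
  have h3 : ((y.1 n : ℕ) : ℝ) ≤ M n := by
    exact_mod_cast Nat.lt_succ_iff.1 (y.1 n).2
  have h4 : (0 : ℝ) ≤ ((D.edgePerm hM y).1 n : ℕ) := Nat.cast_nonneg _
  have h5 : (0 : ℝ) ≤ (y.1 n : ℕ) := Nat.cast_nonneg _
  rw [deviation, abs_le]
  push_cast
  constructor <;> linarith

/-- Without wrap-around the coordinate moves exactly as `cylinderDiff` says. With wrap-around the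
swap restores its value before the turn, so the deviation is `-1` over the first cylinder and `1`
over the second. The last two hypotheses ensure that no later swap interferes. -/
theorem abs_deviation_le_indicator (hM : ∀ n, 1 ≤ M n) {n : ℕ}
    (hPQ : ¬ AgreeUpTo (D.level n) (D.P n) (D.Q n)) {y : BoundedSeq M × Fin d}
    (h1 : ∀ m > n, D.turn y ∉ D.swapSupport m)
    (h2 : ∀ m > n, D.swap n (D.turn y) ∉ D.swapSupport m) :
    |D.deviation hM n y| ≤ (D.turn ⁻¹' D.swapSupport n).indicator 1 y := by
  classical
  have hP : ∀ r, AgreeUpTo (D.level n) (D.turn y) (D.turn r) ↔ AgreeUpTo (D.level n) y r :=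
    fun r => agreeUpTo_turn_iff
  have hval : ((D.edgePerm hM y).1 n : ℕ) = (D.glue (D.turn y)).1 n := rfl
  have hact : D.turn y ∈ D.swapSupport n → D.glue (D.turn y) = D.swap n (D.turn y) := fun h =>
    gluedMap_of_mem ⟨h, fun m hm => ⟨h1 m hm, h2 m hm⟩⟩
  have hnot : D.turn y ∉ D.swapSupport n → (D.glue (D.turn y)).1 n = (D.turn y).1 n := fun h =>
    glue_apply_of_notMem fun m hm => by
      rcases eq_or_lt_of_le hm with rfl | hm
      · exact h
      · exact h1 m hm
  have hin : D.turn y ∈ D.swapSupport n →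
      (D.turn ⁻¹' D.swapSupport n).indicator (1 : BoundedSeq M × Fin d → ℝ) y = 1 := fun h =>
    Set.indicator_of_mem (show y ∈ D.turn ⁻¹' D.swapSupport n from h) _
  have hout : D.turn y ∉ D.swapSupport n →
      (D.turn ⁻¹' D.swapSupport n).indicator (1 : BoundedSeq M × Fin d → ℝ) y = 0 := fun h =>
    Set.indicator_of_notMem (show y ∉ D.turn ⁻¹' D.swapSupport n from h) _
  have hturn := turn_apply (D := D) n y
  by_cases hyP : AgreeUpTo (D.level n) y (D.P n)
  · have hyQ : ¬ AgreeUpTo (D.level n) y (D.Q n) := fun h => hPQ (hyP.symm.trans h)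
    have hdiff : D.cylinderDiff n y = 1 := by
      simp [cylinderDiff, agreeCylinder, hyP, hyQ]
    simp only [levelShift, if_pos hyP, if_neg hyQ, sub_zero] at hturn
    -- Turning forward wraps exactly at the top.
    by_cases hlast : y.1 n = Fin.last (M n)
    · have hz : (D.turn y).1 n = 0 := by rw [hturn, hlast, Fin.last_add_one]
      have hmem : D.turn y ∈ D.swapSupport n := Or.inl ⟨(hP _).2 hyP, hz⟩
      have hsw : (D.glue (D.turn y)).1 n = Fin.last (M n) := by
        rw [hact hmem, swap, blockSwap_left ((hP _).2 hyP) hz, overwrite_apply (D.level_le n)]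
      rw [deviation, hval, hsw, hlast, hdiff, hin hmem]
      simp
    · have hv : ((D.turn y).1 n : ℕ) = y.1 n + 1 := by
        rw [hturn, Fin.val_add_one, if_neg hlast]
      have hmem : D.turn y ∉ D.swapSupport n := by
        rintro (⟨-, h⟩ | ⟨h, -⟩)
        · rw [h] at hv
          simp at hv
        · exact hyQ ((hP _).1 h)
      rw [deviation, hval, hnot hmem, hv, hdiff, hout hmem]
      simp
  by_cases hyQ : AgreeUpTo (D.level n) y (D.Q n)
  · have hdiff : D.cylinderDiff n y = -1 := by
      simp [cylinderDiff, agreeCylinder, hyP, hyQ]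
    simp only [levelShift, if_neg hyP, if_pos hyQ, zero_sub, ← sub_eq_add_neg] at hturn
    by_cases hzero : y.1 n = 0
    · have hz : (D.turn y).1 n = Fin.last (M n) := by
        refine Fin.ext ?_
        rw [hturn, hzero, Fin.coe_sub_one, if_pos rfl, Fin.val_last]
      have hmem : D.turn y ∈ D.swapSupport n := Or.inr ⟨(hP _).2 hyQ, hz⟩
      have hsw : (D.glue (D.turn y)).1 n = 0 := by
        rw [hact hmem, swap, blockSwap_right (zero_ne_last hM n) ((hP _).2 hyQ) hz,
          overwrite_apply (D.level_le n)]
      rw [deviation, hval, hsw, hzero, hdiff, hin hmem]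
      simp
    · have hv : ((D.turn y).1 n : ℕ) = y.1 n - 1 := by
        rw [hturn, Fin.coe_sub_one, if_neg hzero]
      have hpos : 1 ≤ (y.1 n : ℕ) := Nat.one_le_iff_ne_zero.2 fun h => hzero (Fin.ext h)
      have hlt := (y.1 n).2
      have hmem : D.turn y ∉ D.swapSupport n := by
        rintro (⟨h, -⟩ | ⟨-, h⟩)
        · exact hyP ((hP _).1 h)
        · rw [h, Fin.val_last] at hv
          omega
      rw [deviation, hval, hnot hmem, hv, hdiff, hout hmem, Nat.cast_sub hpos]
      simp
  · have hdiff : D.cylinderDiff n y = 0 := by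
      simp [cylinderDiff, agreeCylinder, hyP, hyQ]
    simp only [levelShift, if_neg hyP, if_neg hyQ, sub_zero, add_zero] at hturn
    have hmem : D.turn y ∉ D.swapSupport n := by
      rintro (⟨h, -⟩ | ⟨h, -⟩)
      · exact hyP ((hP _).1 h)
      · exact hyQ ((hP _).1 h)
    rw [deviation, hval, hnot hmem, hturn, hdiff, hout hmem]
    simp

end CylinderPairs

end SwapConstruction

/-! ### Uniqueness of flows -/

section FlowUniqueness

theorem integral_prod_count {X : Type*} [MeasurableSpace X] {d : ℕ} {μ : Measure X} [SFinite μ]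
    {f : X × Fin d → ℝ} (hf : Integrable f (μ.prod Measure.count)) :
    ∫ y, f y ∂μ.prod Measure.count = ∫ x, ∑ i, f (x, i) ∂μ := by
  rw [integral_prod _ hf]
  simp_rw [integral_count]

/-- Conserved edge functions are orthogonal to coboundaries. -/
theorem integral_mul_coboundary {X : Type*} [MeasurableSpace X] {d : ℕ} {μ : Measure X}
    [IsFiniteMeasure μ] (τ : X × Fin d ≃ᵐ X × Fin d)
    (hτ : MeasurePreserving τ (μ.prod Measure.count) (μ.prod Measure.count))
    {g : X × Fin d → ℝ} (hg : Integrable g (μ.prod Measure.count))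
    (hcons : ∀ᵐ x ∂μ, ∑ i, g (x, i) = ∑ i, g (τ.symm (x, i)))
    {ψ : X → ℝ} (hψ : Measurable ψ) {C : ℝ} (hC : ∀ x, |ψ x| ≤ C) :
    ∫ y, g y * (ψ (τ y).1 - ψ y.1) ∂μ.prod Measure.count = 0 := by
  have hψ1 : Integrable (fun y : X × Fin d => g y * ψ y.1) (μ.prod Measure.count) :=
    hg.mul_bdd (c := C) (hψ.comp measurable_fst).aestronglyMeasurable
      (Filter.Eventually.of_forall fun y => hC y.1)
  have hψ2 : Integrable (fun y : X × Fin d => g y * ψ (τ y).1) (μ.prod Measure.count) :=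
    hg.mul_bdd (c := C) (hψ.comp (measurable_fst.comp τ.measurable)).aestronglyMeasurable
      (Filter.Eventually.of_forall fun y => hC (τ y).1)
  have hψ3 : Integrable (fun y : X × Fin d => g (τ.symm y) * ψ y.1) (μ.prod Measure.count) := by
    have := (hτ.symm τ).integrable_comp_of_integrable hψ2
    simpa [Function.comp_def] using this
  -- Substitution along `τ` moves `ψ` from heads to tails and turns `g` into the inflow at that
  -- vertex.
  have h1 : ∫ y, g y * ψ (τ y).1 ∂μ.prod Measure.count =
      ∫ y, g (τ.symm y) * ψ y.1 ∂μ.prod Measure.count := by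
    have := hτ.integral_comp' (g := fun y : X × Fin d => g (τ.symm y) * ψ y.1)
    simpa using this
  simp_rw [mul_sub]
  rw [integral_sub hψ2 hψ1, h1, integral_prod_count hψ3, integral_prod_count hψ1, sub_eq_zero]
  refine integral_congr_ae ?_
  filter_upwards [hcons] with x hx
  simp only [← Finset.sum_mul, hx]

namespace CylinderPairs

variable {M : ℕ → ℕ} {d : ℕ} {D : CylinderPairs M d}

/-- The heights grow so fast that the later coordinates are negligible. -/
def GrowsFast (M : ℕ → ℕ) : Prop :=
  ∀ n, ∑' k, ((M (n + 1 + k) + 1 : ℕ) : ℝ≥0∞)⁻¹ ≤ 2 * (((M n + 1 : ℕ) : ℝ≥0∞)⁻¹) ^ 3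

variable (D) in
/-- The edges whose image under `turn` is moved by a later swap, before or after the `n`-th swap. -/
def laterSupport (n : ℕ) : Set (BoundedSeq M × Fin d) :=
  ⋃ k, D.turn ⁻¹' (D.swapSupport (n + 1 + k) ∪ D.swap n ⁻¹' D.swapSupport (n + 1 + k))

theorem measurableSet_laterSupport (hM : ∀ n, 1 ≤ M n) (n : ℕ) :
    MeasurableSet (D.laterSupport n) :=
  MeasurableSet.iUnion fun _ => measurePreserving_turn.measurable
    ((measurableSet_swapSupport _).union
      ((measurePreserving_swap hM n).measurable (measurableSet_swapSupport _)))

theorem labelledMeasure_laterSupport_le (hM : ∀ n, 1 ≤ M n) (hgrow : GrowsFast M) (n : ℕ) :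
    labelledMeasure M d (D.laterSupport n) ≤ 8 * d * (((M n + 1 : ℕ) : ℝ≥0∞)⁻¹) ^ 3 := by
  have h1 : ∀ k, labelledMeasure M d
      (D.turn ⁻¹' (D.swapSupport (n + 1 + k) ∪ D.swap n ⁻¹' D.swapSupport (n + 1 + k))) ≤
      4 * d * ((M (n + 1 + k) + 1 : ℕ) : ℝ≥0∞)⁻¹ := by
    intro k
    have hm := measurableSet_swapSupport (D := D) (n + 1 + k)
    have hm' := (measurePreserving_swap (D := D) hM n).measurable hm
    rw [measurePreserving_turn.measure_preimage (hm.union hm').nullMeasurableSet]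
    refine (measure_union_le _ _).trans ?_
    rw [(measurePreserving_swap hM n).measure_preimage hm.nullMeasurableSet]
    refine (add_le_add (labelledMeasure_swapSupport_le _)
      (labelledMeasure_swapSupport_le _)).trans (le_of_eq ?_)
    ring
  refine (measure_iUnion_le _).trans ((ENNReal.tsum_le_tsum h1).trans ?_)
  rw [ENNReal.tsum_mul_left]
  refine (mul_le_mul_right (hgrow n) _).trans (le_of_eq ?_)
  ring

theorem measurable_cylinderDiff (n : ℕ) : Measurable (D.cylinderDiff n) :=
  (measurable_one.indicator (measurableSet_agreeCylinder _ _)).sub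
    (measurable_one.indicator (measurableSet_agreeCylinder _ _))

theorem measurable_coord_cast (n : ℕ) :
    Measurable fun x : BoundedSeq M => ((x n : ℕ) : ℝ) :=
  (measurable_of_countable fun a : Fin (M n + 1) => ((a : ℕ) : ℝ)).comp (measurable_pi_apply n)

theorem measurable_deviation (hM : ∀ n, 1 ≤ M n) (n : ℕ) : Measurable (D.deviation hM n) :=
  (((measurable_coord_cast n).comp (measurable_fst.comp (D.edgePerm hM).measurable)).sub
    ((measurable_coord_cast n).comp measurable_fst)).sub (measurable_cylinderDiff n)

/-- The crude bound `M n + 1` is spent only where later swaps interfere; elsewhere the deviation is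
at most `1` and lives on the support of swap `n`. -/
theorem sq_deviation_le (hM : ∀ n, 1 ≤ M n) {n : ℕ}
    (hPQ : ¬ AgreeUpTo (D.level n) (D.P n) (D.Q n)) (y : BoundedSeq M × Fin d) :
    D.deviation hM n y ^ 2 ≤ (D.turn ⁻¹' D.swapSupport n).indicator (fun _ => (1 : ℝ)) y +
      (D.laterSupport n).indicator (fun _ => ((M n + 1 : ℕ) : ℝ) ^ 2) y := by
  classical
  by_cases hy : y ∈ D.laterSupport n
  · have h1 : 0 ≤ (D.turn ⁻¹' D.swapSupport n).indicator (fun _ => (1 : ℝ)) y :=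
      Set.indicator_nonneg (fun _ _ => zero_le_one) _
    rw [Set.indicator_of_mem hy]
    have h2 : D.deviation hM n y ^ 2 ≤ ((M n + 1 : ℕ) : ℝ) ^ 2 :=
      sq_le_sq' (abs_le.1 (abs_deviation_le hM n y)).1 (abs_le.1 (abs_deviation_le hM n y)).2
    linarith
  · rw [Set.indicator_of_notMem hy, add_zero]
    have hy' : ∀ m > n, D.turn y ∉ D.swapSupport m ∧ D.swap n (D.turn y) ∉ D.swapSupport m := by
      intro m hm
      obtain ⟨k, rfl⟩ := Nat.exists_eq_add_of_le (Nat.succ_le_of_lt hm)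
      constructor <;> refine fun h => hy (Set.mem_iUnion.2 ⟨k, ?_⟩)
      · exact Or.inl h
      · exact Or.inr h
    have h1 := abs_deviation_le_indicator hM hPQ (fun m hm => (hy' m hm).1)
      fun m hm => (hy' m hm).2
    rw [← sq_abs]
    by_cases hs : y ∈ D.turn ⁻¹' D.swapSupport n
    · rw [Set.indicator_of_mem hs] at h1 ⊢
      exact pow_le_one₀ (abs_nonneg _) h1
    · rw [Set.indicator_of_notMem hs] at h1 ⊢
      rw [le_antisymm h1 (abs_nonneg _)]
      norm_num

theorem integrable_sq_deviation (hM : ∀ n, 1 ≤ M n) (n : ℕ) :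
    Integrable (fun y => D.deviation hM n y ^ 2) (labelledMeasure M d) := by
  refine Integrable.of_bound ((measurable_deviation hM n).pow_const 2).aestronglyMeasurable
    (((M n + 1 : ℕ) : ℝ) ^ 2) (Filter.Eventually.of_forall fun y => ?_)
  rw [Real.norm_eq_abs, abs_pow]
  exact pow_le_pow_left₀ (abs_nonneg _) (abs_deviation_le hM n y) 2

/-- The swap support contributes `2d / (M n + 1)`. Later swaps contribute at most `8d (M n + 1)⁻³ ·
(M n + 1)²`: the cube in `GrowsFast` is there to beat this square. -/
theorem integral_sq_deviation_le (hM : ∀ n, 1 ≤ M n) (hgrow : GrowsFast M) {n : ℕ}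
    (hPQ : ¬ AgreeUpTo (D.level n) (D.P n) (D.Q n)) :
    ∫ y, D.deviation hM n y ^ 2 ∂labelledMeasure M d ≤ 10 * d / (M n + 1 : ℕ) := by
  have hm1 : MeasurableSet (D.turn ⁻¹' D.swapSupport n) :=
    measurePreserving_turn.measurable (measurableSet_swapSupport n)
  have hm2 := measurableSet_laterSupport (D := D) hM n
  have hN : ((M n + 1 : ℕ) : ℝ) ≠ 0 := by positivity
  have hNtop : ((M n + 1 : ℕ) : ℝ≥0∞)⁻¹ ≠ ⊤ := ENNReal.inv_ne_top.2 (by simp)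
  have h1 : (labelledMeasure M d).real (D.turn ⁻¹' D.swapSupport n) ≤
      2 * d * ((M n + 1 : ℕ) : ℝ)⁻¹ := by
    have h := ENNReal.toReal_mono (ENNReal.mul_ne_top (by finiteness) hNtop)
      (labelledMeasure_swapSupport_le (D := D) n)
    rw [measureReal_def, measurePreserving_turn.measure_preimage
      (measurableSet_swapSupport n).nullMeasurableSet]
    simpa only [ENNReal.toReal_mul, ENNReal.toReal_inv, ENNReal.toReal_natCast,
      ENNReal.toReal_ofNat] using h
  have h2 : (labelledMeasure M d).real (D.laterSupport n) ≤
      8 * d * (((M n + 1 : ℕ) : ℝ)⁻¹) ^ 3 := by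
    have h := ENNReal.toReal_mono (ENNReal.mul_ne_top (by finiteness) (ENNReal.pow_ne_top hNtop))
      (labelledMeasure_laterSupport_le (D := D) hM hgrow n)
    rw [measureReal_def]
    simpa only [ENNReal.toReal_mul, ENNReal.toReal_pow, ENNReal.toReal_inv,
      ENNReal.toReal_natCast, ENNReal.toReal_ofNat] using h
  have hi1 : Integrable ((D.turn ⁻¹' D.swapSupport n).indicator fun _ => (1 : ℝ))
      (labelledMeasure M d) := (integrable_const _).indicator hm1
  have hi2 : Integrable ((D.laterSupport n).indicator fun _ => ((M n + 1 : ℕ) : ℝ) ^ 2)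
      (labelledMeasure M d) := (integrable_const _).indicator hm2
  refine (integral_mono (integrable_sq_deviation hM n) (hi1.add hi2)
    (sq_deviation_le hM hPQ)).trans ?_
  simp only [Pi.add_apply]
  rw [integral_add hi1 hi2, integral_indicator_const _ hm1, integral_indicator_const _ hm2,
    smul_eq_mul, smul_eq_mul, mul_one]
  calc _ ≤ 2 * d * ((M n + 1 : ℕ) : ℝ)⁻¹ +
        8 * d * (((M n + 1 : ℕ) : ℝ)⁻¹) ^ 3 * ((M n + 1 : ℕ) : ℝ) ^ 2 := by gcongr
    _ = 10 * d / (M n + 1 : ℕ) := by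
      field_simp
      ring

variable (D) in
/-- Every pair of cylinders occurs infinitely often. -/
def Exhaustive : Prop :=
  ∀ m y y' n₀, ∃ n ≥ n₀, D.level n = m ∧ AgreeUpTo m (D.P n) y ∧ AgreeUpTo m (D.Q n) y'

theorem integral_mul_cylinderDiff (n : ℕ) {g : BoundedSeq M × Fin d → ℝ}
    (hg : Integrable g (labelledMeasure M d)) :
    ∫ y, g y * D.cylinderDiff n y ∂labelledMeasure M d =
      ∫ y in agreeCylinder (D.level n) (D.P n), g y ∂labelledMeasure M d -
        ∫ y in agreeCylinder (D.level n) (D.Q n), g y ∂labelledMeasure M d := by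
  have h : ∀ (s : Set (BoundedSeq M × Fin d)) y, g y * s.indicator 1 y = s.indicator g y := by
    intro s y
    by_cases hy : y ∈ s <;> simp [hy]
  simp_rw [cylinderDiff, mul_sub, h]
  rw [integral_sub (hg.indicator (measurableSet_agreeCylinder _ _))
    (hg.indicator (measurableSet_agreeCylinder _ _)),
    integral_indicator (measurableSet_agreeCylinder _ _),
    integral_indicator (measurableSet_agreeCylinder _ _)]

/-- By orthogonality to the coboundary of coordinate `n`, the difference is minus the integral of
`g` times the deviation. Young's inequality with free parameter `δ` then does the work of
Cauchy–Schwarz. -/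
theorem abs_setIntegral_sub_le (hM : ∀ n, 1 ≤ M n) (hgrow : GrowsFast M) {n : ℕ}
    (hPQ : ¬ AgreeUpTo (D.level n) (D.P n) (D.Q n)) {g : BoundedSeq M × Fin d → ℝ}
    (hg : MemLp g 2 (labelledMeasure M d))
    (hcons : ∀ᵐ x ∂seqMeasure M, ∑ i, g (x, i) = ∑ i, g ((D.edgePerm hM).symm (x, i)))
    {δ : ℝ} (hδ : 0 < δ) :
    |∫ y in agreeCylinder (D.level n) (D.P n), g y ∂labelledMeasure M d -
        ∫ y in agreeCylinder (D.level n) (D.Q n), g y ∂labelledMeasure M d| ≤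
      δ * (∫ y, g y ^ 2 ∂labelledMeasure M d) + δ⁻¹ * (10 * d / (M n + 1 : ℕ)) := by
  have hg1 : Integrable g (labelledMeasure M d) := hg.integrable one_le_two
  have hdev : Integrable (fun y => g y * D.deviation hM n y) (labelledMeasure M d) :=
    hg1.mul_bdd (c := (M n + 1 : ℕ)) (measurable_deviation hM n).aestronglyMeasurable
      (Filter.Eventually.of_forall fun y => abs_deviation_le hM n y)
  have hcyl : Integrable (fun y => g y * D.cylinderDiff n y) (labelledMeasure M d) :=
    hg1.mul_bdd (c := 1) (measurable_cylinderDiff n).aestronglyMeasurable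
      (Filter.Eventually.of_forall fun y => D.abs_cylinderDiff_le n y)
  have h0 := integral_mul_coboundary (D.edgePerm hM) (measurePreserving_edgePerm hM) hg1 hcons
    (measurable_coord_cast n) (C := (M n : ℝ)) fun x => by
      rw [abs_of_nonneg (Nat.cast_nonneg _)]
      exact_mod_cast Nat.lt_succ_iff.1 (x n).2
  have h1 : ∀ y : BoundedSeq M × Fin d,
      g y * (((D.edgePerm hM y).1 n : ℕ) - (y.1 n : ℕ) : ℝ) =
      g y * D.deviation hM n y + g y * D.cylinderDiff n y := fun y => by
    rw [deviation]
    ring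
  simp_rw [h1] at h0
  rw [integral_add hdev hcyl, integral_mul_cylinderDiff n hg1] at h0
  rw [eq_neg_of_add_eq_zero_right h0, abs_neg]
  have hsq := hg.integrable_sq
  calc |∫ y, g y * D.deviation hM n y ∂labelledMeasure M d|
      ≤ ∫ y, |g y * D.deviation hM n y| ∂labelledMeasure M d := abs_integral_le_integral_abs
    _ ≤ ∫ y, (δ * g y ^ 2 + δ⁻¹ * D.deviation hM n y ^ 2) ∂labelledMeasure M d := by
      refine integral_mono hdev.abs
        ((hsq.const_mul δ).add ((integrable_sq_deviation hM n).const_mul δ⁻¹)) fun y => ?_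
      have h2 : 0 ≤ δ⁻¹ * (δ * |g y| - |D.deviation hM n y|) ^ 2 := by positivity
      have h3 : δ⁻¹ * (δ * |g y| - |D.deviation hM n y|) ^ 2 =
          δ * |g y| ^ 2 - 2 * (|g y| * |D.deviation hM n y|) +
            δ⁻¹ * |D.deviation hM n y| ^ 2 := by
        field_simp
        ring
      have h4 : 0 ≤ |g y| * |D.deviation hM n y| := by positivity
      simp only [abs_mul]
      rw [← sq_abs (g y), ← sq_abs (D.deviation hM n y)]
      linarith
    _ = δ * (∫ y, g y ^ 2 ∂labelledMeasure M d) +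
        δ⁻¹ * ∫ y, D.deviation hM n y ^ 2 ∂labelledMeasure M d := by
      rw [integral_add (hsq.const_mul δ) ((integrable_sq_deviation hM n).const_mul δ⁻¹),
        integral_const_mul, integral_const_mul]
    _ ≤ _ := by
      gcongr
      exact integral_sq_deviation_le hM hgrow hPQ

theorem hasUniqueFlow [NeZero d] (hM : ∀ n, 1 ≤ M n) (hMn : ∀ n, n ≤ M n) (hgrow : GrowsFast M)
    (hD : D.Exhaustive) : HasUniqueFlow (seqMeasure M) (D.edgePerm hM).toEquiv := by
  intro g hg hcons
  refine ae_const_of_setIntegral_agreeCylinder (hg.integrable one_le_two) fun m q q' => ?_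
  by_cases hqq : AgreeUpTo m q q'
  · rw [agreeCylinder_congr hqq]
  set F := ∫ y, g y ^ 2 ∂labelledMeasure M d
  have hF : 0 ≤ F := integral_nonneg fun y => sq_nonneg _
  rw [← sub_eq_zero, ← abs_eq_zero]
  refine le_antisymm (le_of_forall_pos_le_add fun ε hε => ?_) (abs_nonneg _)
  -- Chosen so that `δ * F + δ = ε`; the next line makes the remaining term at most `δ`, by `n ≤ M
  -- n`.
  set δ := ε / (F + 1)
  have hδ : 0 < δ := by positivity
  obtain ⟨n₀, hn₀⟩ := exists_nat_ge (10 * d / δ ^ 2)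
  obtain ⟨n, hn, rfl, hP, hQ⟩ := hD m q q' n₀
  have hPQ : ¬ AgreeUpTo (D.level n) (D.P n) (D.Q n) := fun h =>
    hqq (hP.symm.trans (h.trans hQ))
  have h1 := abs_setIntegral_sub_le hM hgrow hPQ hg hcons hδ
  rw [agreeCylinder_congr hP, agreeCylinder_congr hQ] at h1
  refine h1.trans ?_
  have h2 : 10 * d / δ ^ 2 ≤ ((M n + 1 : ℕ) : ℝ) :=
    hn₀.trans (by exact_mod_cast hn.trans ((hMn n).trans (Nat.le_succ _)))
  have h3 : δ⁻¹ * (10 * d / (M n + 1 : ℕ)) ≤ δ := by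
    have hN : (0 : ℝ) < (M n + 1 : ℕ) := by positivity
    rw [div_le_iff₀ (by positivity)] at h2
    rw [inv_mul_le_iff₀ hδ, div_le_iff₀ hN]
    linarith
  calc δ * F + δ⁻¹ * (10 * d / (M n + 1 : ℕ)) ≤ δ * F + δ := by gcongr
    _ = ε := by
      simp only [δ]
      field_simp
    _ = 0 + ε := (zero_add _).symm

end CylinderPairs

end FlowUniqueness

/-! ### Separating edges by coordinates, and the choice of parameters -/

section Separation

theorem AgreeUpTo.eventually_not {M : ℕ → ℕ} {d : ℕ} {y y' : BoundedSeq M × Fin d} (h : y ≠ y') :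
    ∀ᶠ m in Filter.atTop, ¬ AgreeUpTo m y y' := by
  obtain ⟨m, hm⟩ : ∃ m, ¬ AgreeUpTo m y y' := by
    by_contra hcon
    push Not at hcon
    exact h (AgreeUpTo.eq_of_forall hcon)
  filter_upwards [Filter.eventually_ge_atTop m] with n hn
  exact fun h' => hm (h'.mono hn)

namespace CylinderPairs

variable {M : ℕ → ℕ} {d : ℕ} {D : CylinderPairs M d}

variable (D) in
/-- The edges whose image under `turn` lies in only finitely many swap supports. -/
def eventuallyUnswapped : Set (BoundedSeq M × Fin d) :=
  {y | ∀ᶠ n in Filter.atTop, y ∉ D.turn ⁻¹' D.swapSupport n}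

theorem measurableSet_eventuallyUnswapped : MeasurableSet D.eventuallyUnswapped := by
  have : D.eventuallyUnswapped = ⋃ k, ⋂ n, ⋂ (_ : n ≥ k), (D.turn ⁻¹' D.swapSupport n)ᶜ := by
    ext y
    simp [eventuallyUnswapped, Filter.eventually_atTop]
  rw [this]
  exact MeasurableSet.iUnion fun k => MeasurableSet.iInter fun n => MeasurableSet.iInter fun _ =>
    (measurePreserving_turn.measurable (measurableSet_swapSupport n)).compl

/-- Borel–Cantelli; `GrowsFast` at `0` bounds all terms of the series but the first. -/
theorem ae_mem_eventuallyUnswapped (hgrow : GrowsFast M) :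
    ∀ᵐ y ∂labelledMeasure M d, y ∈ D.eventuallyUnswapped := by
  refine ae_eventually_notMem (ne_top_of_le_ne_top (b := ∑' n, 2 * d * ((M n + 1 : ℕ) : ℝ≥0∞)⁻¹)
    ?_ (ENNReal.tsum_le_tsum fun n => ?_))
  · rw [ENNReal.tsum_mul_left]
    refine ENNReal.mul_ne_top (by finiteness) ?_
    rw [tsum_eq_zero_add' ENNReal.summable]
    have h0 : ∀ n, ((M n + 1 : ℕ) : ℝ≥0∞)⁻¹ ≠ ⊤ := fun n => ENNReal.inv_ne_top.2 (by simp)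
    refine ENNReal.add_ne_top.2 ⟨h0 0, ne_top_of_le_ne_top ?_ (le_trans (le_of_eq ?_) (hgrow 0))⟩
    · exact ENNReal.mul_ne_top (by finiteness) (ENNReal.pow_ne_top (h0 0))
    · exact tsum_congr fun k => by rw [zero_add, add_comm 1 k]
  · rw [measurePreserving_turn.measure_preimage (measurableSet_swapSupport n).nullMeasurableSet]
    exact labelledMeasure_swapSupport_le n

theorem infinite_labelledSeq [NeZero d] (hM : ∀ n, 1 ≤ M n) : Infinite (BoundedSeq M × Fin d) := by
  refine Infinite.of_injective
    (fun n : ℕ => ((Pi.single n (Fin.last (M n)) : BoundedSeq M), (0 : Fin d))) fun m n h => ?_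
  by_contra hne
  have h1 := congrFun (congrArg Prod.fst h) m
  simp only [Pi.single_eq_same, Pi.single_eq_of_ne hne] at h1
  exact zero_ne_last hM m h1.symm

theorem exists_separating_coord [NeZero d] (hM : ∀ n, 1 ≤ M n) (hD : D.Exhaustive)
    (F : Finset (BoundedSeq M × Fin d)) (hF : ∀ y ∈ F, y ∈ D.eventuallyUnswapped)
    (y₀ : BoundedSeq M × Fin d) (hy₀ : y₀ ∈ D.eventuallyUnswapped) :
    ∃ ψ : BoundedSeq M → ℕ, ψ (D.edgePerm hM y₀).1 ≠ ψ y₀.1 ∧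
      ∀ y ∈ F, y ≠ y₀ → ψ (D.edgePerm hM y).1 = ψ y.1 := by
  classical
  have := infinite_labelledSeq (d := d) hM
  -- The centre of the second cylinder, which is to contain none of the given edges.
  obtain ⟨q, hq⟩ := Infinite.exists_notMem_finset (insert y₀ F)
  have h1 : ∀ᶠ m in Filter.atTop, ∀ y ∈ insert y₀ F, ¬ AgreeUpTo m y q :=
    (Filter.eventually_all_finset _).2 fun y hy =>
      AgreeUpTo.eventually_not fun h => hq (h ▸ hy)
  have h2 : ∀ᶠ m in Filter.atTop, ∀ y ∈ F, y ≠ y₀ → ¬ AgreeUpTo m y y₀ :=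
    (Filter.eventually_all_finset _).2 fun y _ => by
      by_cases h : y = y₀
      · exact Filter.Eventually.of_forall fun _ h' => (h' h).elim
      · filter_upwards [AgreeUpTo.eventually_not h] with m hm _ using hm
  have h3 : ∀ᶠ n in Filter.atTop, ∀ y ∈ insert y₀ F, ∀ k ≥ n, D.turn y ∉ D.swapSupport k := by
    refine (Filter.eventually_all_finset _).2 fun y hy => Filter.eventually_forall_ge_atTop.2 ?_
    rcases Finset.mem_insert.1 hy with rfl | hy
    · exact hy₀
    · exact hF y hy
  obtain ⟨m, hm1, hm2⟩ := (h1.and h2).exists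
  obtain ⟨n₀, hn₀⟩ := h3.exists
  -- From `n₀` on no swap moves the given edges, so coordinate `n` changes along them only by the
  -- turn: by `1` along `y₀` and not at all along the others.
  obtain ⟨n, hn, rfl, hP, hQ⟩ := hD m y₀ q n₀
  have hcoord : ∀ y ∈ insert y₀ F,
      (D.edgePerm hM y).1 n = y.1 n + levelShift D.P D.Q D.level n y := by
    intro y hy
    rw [edgePerm_apply, glue_apply_of_notMem fun k hk => hn₀ y hy k (hn.trans hk), turn_apply]
  have hnQ : ∀ y ∈ insert y₀ F, ¬ AgreeUpTo (D.level n) y (D.Q n) := fun y hy h =>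
    hm1 y hy (h.trans hQ)
  refine ⟨fun x => x n, ?_, fun y hy hne => ?_⟩
  · have hmem := Finset.mem_insert_self y₀ F
    intro h
    have h4 := (hcoord y₀ hmem).symm.trans (Fin.ext h)
    rw [levelShift, if_pos hP.symm, if_neg (hnQ y₀ hmem), sub_zero, add_eq_left] at h4
    have h5 := congrArg Fin.val h4
    have h6 := hM n
    rw [Fin.val_one', Fin.val_zero, Nat.mod_eq_of_lt (by omega)] at h5
    omega
  · have hmem : y ∈ insert y₀ F := Finset.mem_insert_of_mem hy
    have h4 : ¬ AgreeUpTo (D.level n) y (D.P n) := fun h => hm2 y hy hne (h.trans hP)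
    simp only [hcoord y hmem, levelShift, if_neg h4, if_neg (hnQ y hmem), sub_zero, add_zero]

theorem exists_exhaustive (M : ℕ → ℕ) (d : ℕ) [NeZero d] : ∃ D : CylinderPairs M d, D.Exhaustive := by
  let W : ℕ → Type := fun m => (∀ k : Fin m, Fin (M k + 1)) × Fin d
  have : Nonempty (Σ m, W m × W m) := ⟨⟨0, (fun _ => 0, 0), (fun _ => 0, 0)⟩⟩
  obtain ⟨e, he⟩ := exists_surjective_nat (Σ m, W m × W m)
  -- Ignoring the second component of `unpair` repeats every pair of words infinitely often. The
  -- level is capped at `n` below; indices at least `m` make the cap inactive.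
  let t : ℕ → Σ m, W m × W m := fun n => e n.unpair.1
  refine ⟨⟨fun n => extendWord (t n).1 (t n).2.1, fun n => extendWord (t n).1 (t n).2.2,
    fun n => min (t n).1 n, fun n => min_le_right _ _⟩, fun m y y' n₀ => ?_⟩
  obtain ⟨k, hk⟩ := he ⟨m, truncateWord m y, truncateWord m y'⟩
  have ht : t (Nat.pair k (max n₀ m)) = ⟨m, truncateWord m y, truncateWord m y'⟩ := by
    simp only [t, Nat.unpair_pair, hk]
  have hle : max n₀ m ≤ Nat.pair k (max n₀ m) := Nat.right_le_pair _ _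
  refine ⟨Nat.pair k (max n₀ m), (le_max_left _ _).trans hle, ?_, ?_, ?_⟩
  · simp only [ht]
    exact min_eq_left ((le_max_right _ _).trans hle)
  · change AgreeUpTo m (extendWord (t _).1 (t _).2.1) y
    rw [ht]
    exact (agreeUpTo_extendWord_iff.2 rfl).symm
  · change AgreeUpTo m (extendWord (t _).1 (t _).2.2) y'
    rw [ht]
    exact (agreeUpTo_extendWord_iff.2 rfl).symm

end CylinderPairs

/-- Tripling the exponent cubes the reciprocal; the rest of the tail is dominated by a geometric
series of sum `2`. -/
theorem growsFast_two_pow_three_pow : CylinderPairs.GrowsFast fun n => 2 ^ 3 ^ n - 1 := by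
  intro n
  have hsucc : ∀ n : ℕ, 2 ^ 3 ^ n - 1 + 1 = 2 ^ 3 ^ n := fun n =>
    Nat.sub_add_cancel Nat.one_le_two_pow
  have hle : ∀ k, 3 ^ (n + 1) + k ≤ 3 ^ (n + 1 + k) := by
    intro k
    have h1 : k < 3 ^ k := Nat.lt_pow_self (by norm_num)
    have h2 : 1 ≤ 3 ^ (n + 1) := Nat.one_le_pow _ _ (by norm_num)
    rw [pow_add 3 (n + 1) k]
    nlinarith
  simp only [hsucc]
  push_cast
  simp_rw [ENNReal.inv_pow]
  calc ∑' k, ((2 : ℝ≥0∞)⁻¹) ^ 3 ^ (n + 1 + k)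
      ≤ ∑' k, ((2 : ℝ≥0∞)⁻¹) ^ 3 ^ (n + 1) * (2⁻¹) ^ k := by
        refine ENNReal.tsum_le_tsum fun k => ?_
        rw [← pow_add]
        exact pow_le_pow_right_of_le_one' (ENNReal.inv_le_one.2 one_le_two) (hle k)
    _ = 2 * ((2⁻¹) ^ 3 ^ n) ^ 3 := by
        rw [ENNReal.tsum_mul_left, ENNReal.tsum_geometric, ENNReal.one_sub_inv_two, inv_inv,
          mul_comm, ← pow_mul, ← pow_succ]

/-- There are separating edge permutations with unique flow. -/
theorem exists_separating_uniqueFlow (d : ℕ) [NeZero d] :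
    ∃ (X : Type) (_ : MeasurableSpace X) (_ : StandardBorelSpace X) (μ : Measure X)
      (_ : IsProbabilityMeasure μ) (τ : X × Fin d ≃ᵐ X × Fin d),
      MeasurePreserving τ (μ.prod Measure.count) (μ.prod Measure.count) ∧
      IsSeparating τ.toEquiv ∧ HasUniqueFlow μ τ.toEquiv := by
  have hlt : ∀ n, n < 2 ^ 3 ^ n := fun n =>
    (Nat.lt_pow_self (by norm_num : 1 < 3)).trans Nat.lt_two_pow_self
  have hM : ∀ n, 1 ≤ 2 ^ 3 ^ n - 1 := fun n =>
    Nat.le_sub_of_add_le (Nat.le_self_pow (pow_ne_zero n three_ne_zero) 2)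
  obtain ⟨D, hD⟩ := CylinderPairs.exists_exhaustive (fun n => 2 ^ 3 ^ n - 1) d
  exact exists_separating_restriction (D.edgePerm hM) (CylinderPairs.measurePreserving_edgePerm hM)
    (CylinderPairs.hasUniqueFlow hM (fun n => Nat.le_sub_one_of_lt (hlt n))
      growsFast_two_pow_three_pow hD)
    CylinderPairs.measurableSet_eventuallyUnswapped
    (CylinderPairs.ae_mem_eventuallyUnswapped growsFast_two_pow_three_pow)
    (CylinderPairs.exists_separating_coord hM hD)

end Separation

theorem theorem2 (d : ℕ) (hd : 2 ≤ d) :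
    ∃ (X : Type) (_ : MeasurableSpace X) (_ : StandardBorelSpace X)
      (μ : Measure X) (_ : IsProbabilityMeasure μ) (G : SimpleGraph X) (O : Set (X × X)),
      IsTreeing G μ ∧ IsRegularGraph G (2 * d) ∧
      IsBalancedOrientation G μ d O ∧
      (∀ f : X × X → ℝ, MemLp f 2 (edgeMeasure G μ (2 * d)) →
        (IsCirculation G μ (2 * d) f ↔
          ∃ c : ℝ, f =ᵐ[edgeMeasure G μ (2 * d)] fun e => c * signedIndicator O e)) ∧
      (¬ ∃ (O' : Set (X × X)) (c : X × X → Fin d), IsSchreierDecoration G μ d O' c) ∧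
      ¬ IsGeneratedByFreeAction G μ d ∧
      ¬ DecomposesIntoPathsAndCycles G μ (2 * d) (signedIndicator O) := by
  have : NeZero d := ⟨by omega⟩
  obtain ⟨X, _, _, μ, _, τ, hτ, hs, hu⟩ := exists_separating_uniqueFlow d
  exact ⟨X, _, inferInstance, μ, inferInstance, edgePermGraph τ.toEquiv,
    edgePermOrientation τ.toEquiv,
    ⟨isGraphing_edgePermGraph hs hτ, Filter.Eventually.of_forall hs.isAcyclic⟩,
    hs.isRegularGraph, isBalancedOrientation_edgePerm hs, isCirculation_iff hs hτ hu,
    not_isSchreierDecoration hd hs hτ hu, not_isGeneratedByFreeAction hd hs hτ hu,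
    not_decomposesIntoPathsAndCycles hd hs hτ hu⟩
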